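/- Let $d\ge 1$ and let $\mathsf A$ be a nonempty compact set of invertible real $d\times d$ matrices. Write $\sigma_1(B)\ge\cdots\ge\sigma_d(B)$ for the singular values of a $d\times d$ matrix $B$. Say that $\mathsf A$ is *1-dominated* if either $d=1$, or $d\ge 2$ and there exist constants $C,\gamma>0$ such that $$\sigma_2(A_n\cdots A_1)\le C e^{-\gamma n}\,\sigma_1(A_n\cdots A_1)$$ for every $n\ge 1$ and all $A_1,\dots,A_n\in\mathsf A$. Say that $\mathsf A$ is *multipositive* if it admits a *multicone*, that is, a tuple $(\mathcal K_1,\dots,\mathcal K_m)$ of subsets of $\mathbb R^d$, for some $m\ge 1$, such that: (i) each $\mathcal K_j$ is closed and convex, has nonempty interior, and satisfies $\lambda\mathcal K_j\subseteq\mathcal K_j$ for every real $\lambda\ge 0$; (ii) there is a unit vector $w\in\mathbb R^d$ such that $\langle u,w\rangle>0$ for every nonzero $u\in\bigcup_{j=1}^m\mathcal K_j$; (iii) for every $A\in\mathsf A$ and every $j\in\{1,\dots,m\}$ there is $\ell\in\{1,\dots,m\}$ such that $A(\mathcal K_j\setminus\{0\})\subseteq(\operatorname{Int}\mathcal K_\ell)\cup(-\operatorname{Int}\mathcal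 K_\ell)$; (iv) $\mathcal K_{j_1}\cap\mathcal K_{j_2}=\{0\}$ for all distinct $j_1,j_2\in\{1,\dots,m\}$. Then $\mathsf A$ is 1-dominated if and only if it is multipositive. -/

import Mathlib

open scoped Pointwise

/-- The `k`-th largest singular value `σ_k(A)` of a real `d × d` matrix, for `1 ≤ k ≤ d`
(Mathlib numbers the singular values from `0`). -/
noncomputable def sigma {d : ℕ} (k : ℕ) (A : Matrix (Fin d) (Fin d) ℝ) : ℝ :=
  (Matrix.toEuclideanLin A).singularValues (k - 1)

/-- `k`-domination of a set `S` of real `d × d` matrices, `0 ≤ k ≤ d`. By convention every set is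
`0`-dominated and `d`-dominated; for `1 ≤ k < d` there must be `C, γ > 0` such that
`σ_{k+1}(A_n ⋯ A_1) ≤ C e^{-γ n} σ_k(A_n ⋯ A_1)` for all `n ≥ 1` and all `A_1, …, A_n ∈ S`.
The list `w` is `[A_n, …, A_1]`. -/
def IsDominated {d : ℕ} (k : ℕ) (S : Set (Matrix (Fin d) (Fin d) ℝ)) : Prop :=
  k = 0 ∨ k = d ∨
    (1 ≤ k ∧ k < d ∧ ∃ C γ : ℝ, 0 < C ∧ 0 < γ ∧
      ∀ n : ℕ, 1 ≤ n → ∀ w : List (Matrix (Fin d) (Fin d) ℝ), w.length = n →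
        (∀ A ∈ w, A ∈ S) →
          sigma (k + 1) w.prod ≤ C * Real.exp (-γ * n) * sigma k w.prod)

/-- The finite family `K` of subsets of `ℝ^d` is a multicone for the set `S` of matrices. -/
structure IsMulticone {d m : ℕ} (S : Set (Matrix (Fin d) (Fin d) ℝ))
    (K : Fin m → Set (EuclideanSpace ℝ (Fin d))) : Prop where
  isClosed : ∀ j, IsClosed (K j)
  convex : ∀ j, Convex ℝ (K j)
  interior_nonempty : ∀ j, (interior (K j)).Nonempty
  smul_subset : ∀ j, ∀ r : ℝ, 0 ≤ r → r • K j ⊆ K j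
  transverse : ∃ w : EuclideanSpace ℝ (Fin d), ‖w‖ = 1 ∧
    ∀ u ∈ ⋃ j, K j, u ≠ 0 → 0 < inner ℝ u w
  mapsTo : ∀ A ∈ S, ∀ j, ∃ l,
    Matrix.toEuclideanLin A '' (K j \ {0}) ⊆ interior (K l) ∪ -interior (K l)
  inter_eq : ∀ i j, i ≠ j → K i ∩ K j = {0}

/-- `S` is multipositive if it admits a multicone `(K_1, …, K_m)` for some `m ≥ 1`. -/
def IsMultipositive {d : ℕ} (S : Set (Matrix (Fin d) (Fin d) ℝ)) : Prop :=
  ∃ m : ℕ, 1 ≤ m ∧ ∃ K : Fin m → Set (EuclideanSpace ℝ (Fin d)), IsMulticone S K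

/-! Domination says that long products look like rank-one maps; a multicone says that finitely many
acute cones are mapped strictly inside one another up to sign.

From domination to cones: products with small `σ₂/σ₁` have almost multiplicative norms
(`exists_quasiMultiplicative`), so some vector has an orbit on which every further product acts with
nearly full norm (`exists_expanded_orbit`), and such vectors stay away from a fixed hyperplane
(`exists_transverse`). Around a unit vector `u` of the orbit, `dominatedCone` collects the `y` with
`‖Qu ∧ Qy‖ ≤ δ r ^ n ‖Qu‖² ⟪u, y⟫` for all products `Q` of length `n`. The weight `r ^ n` plays the
role of an adapted metric: a single generator already sharpens `δ` (`apply_mem_dominatedCone`), and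
the slack gained allows `u` to be replaced by a nearby point of a finite net
(`mem_interior_dominatedCone`). The resulting cones may overlap. They are merged along the finest
equivalence relation whose class cones are disjoint away from `0`; minimality forces every generator
to respect this relation (`IsPreMulticone.exists_disjoint`).

From cones to domination: compactness makes the strict inclusion uniform, so order intervals for the
cones shrink by a fixed factor under each generator, as in Birkhoff's contraction principle
(`exists_interval_contraction`). The image of the unit ball is then exponentially close, relative to
the norm of the product, to a line, which bounds `σ₂` (`exists_dominated`). -/

/-! ### Singular values of endomorphisms. -/

section SingularValues

variable {E : Type*} [NormedAddCommGroup E] [InnerProductSpace ℝ E] [FiniteDimensional ℝ E]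

/-- The second singular value of an endomorphism. -/
noncomputable def secondSingularValue (T : E →L[ℝ] E) : ℝ :=
  (T : E →ₗ[ℝ] E).singularValues 1

lemma secondSingularValue_nonneg (T : E →L[ℝ] E) : 0 ≤ secondSingularValue T :=
  LinearMap.singularValues_nonneg _ _

/-- An orthonormal basis of right singular vectors. -/
noncomputable def rightSingularBasis (T : E →L[ℝ] E) :
    OrthonormalBasis (Fin (Module.finrank ℝ E)) ℝ E :=
  (T : E →ₗ[ℝ] E).isSymmetric_adjoint_comp_self.eigenvectorBasis rfl

lemma norm_apply_sq_eq_sum (T : E →L[ℝ] E) (x : E) :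
    ‖T x‖ ^ 2 = ∑ i : Fin (Module.finrank ℝ E), ((T : E →ₗ[ℝ] E).singularValues i) ^ 2 *
      (inner ℝ (rightSingularBasis T i) x) ^ 2 := by
  have h1 : ‖T x‖ ^ 2 =
      inner ℝ x ((LinearMap.adjoint (T : E →ₗ[ℝ] E) ∘ₗ (T : E →ₗ[ℝ] E)) x) := by
    rw [LinearMap.comp_apply, LinearMap.adjoint_inner_right]
    exact (real_inner_self_eq_norm_sq _).symm
  rw [h1, ← (rightSingularBasis T).sum_inner_mul_inner]
  refine Finset.sum_congr rfl fun i _ => ?_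
  have h2 := (T : E →ₗ[ℝ] E).isSymmetric_adjoint_comp_self.eigenvectorBasis_apply_self_apply
    rfl x i
  rw [OrthonormalBasis.repr_apply_apply, OrthonormalBasis.repr_apply_apply] at h2
  rw [LinearMap.sq_singularValues_fin _ rfl i]
  simp only [RCLike.ofReal_real_eq_id, id_eq] at h2
  rw [rightSingularBasis, h2, real_inner_comm x]
  ring

lemma norm_sq_eq_sum_rightSingularBasis (T : E →L[ℝ] E) (x : E) :
    ‖x‖ ^ 2 = ∑ i, (inner ℝ (rightSingularBasis T i) x) ^ 2 := by
  rw [← (rightSingularBasis T).sum_sq_norm_inner_right x]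
  simp

lemma norm_apply_rightSingularBasis (T : E →L[ℝ] E) (i : Fin (Module.finrank ℝ E)) :
    ‖T (rightSingularBasis T i)‖ = (T : E →ₗ[ℝ] E).singularValues i := by
  have h := norm_apply_sq_eq_sum T (rightSingularBasis T i)
  simp only [OrthonormalBasis.inner_eq_ite, ite_pow, mul_ite] at h
  simp only [ne_eq, OfNat.ofNat_ne_zero, not_false_eq_true, zero_pow, one_pow, mul_zero, mul_one,
    Finset.sum_ite_eq', Finset.mem_univ, if_true] at h
  exact (pow_left_inj₀ (norm_nonneg _) (LinearMap.singularValues_nonneg _ _) two_ne_zero).1 h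

lemma singularValues_zero_eq_norm [Nontrivial E] (T : E →L[ℝ] E) :
    (T : E →ₗ[ℝ] E).singularValues 0 = ‖T‖ := by
  have hpos : 0 < Module.finrank ℝ E := Module.finrank_pos
  apply le_antisymm
  · have h := norm_apply_rightSingularBasis T ⟨0, hpos⟩
    rw [← h]
    simpa using T.le_opNorm (rightSingularBasis T ⟨0, hpos⟩)
  · refine T.opNorm_le_bound (LinearMap.singularValues_nonneg _ _) fun x => ?_
    refine le_of_sq_le_sq ?_ (by have := LinearMap.singularValues_nonneg (T : E →ₗ[ℝ] E) 0; positivity)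
    rw [norm_apply_sq_eq_sum, mul_pow, norm_sq_eq_sum_rightSingularBasis T x, Finset.mul_sum]
    gcongr with i
    · exact LinearMap.singularValues_nonneg _ _
    · exact LinearMap.singularValues_antitone _ (Nat.zero_le _)

/-- There is a unit vector realizing the operator norm on whose orthogonal complement the operator
is bounded by its second singular value. -/
lemma exists_top_singular_vector [Nontrivial E] (T : E →L[ℝ] E) :
    ∃ v : E, ‖v‖ = 1 ∧ ‖T v‖ = ‖T‖ ∧
      ∀ x, inner ℝ v x = 0 → ‖T x‖ ≤ secondSingularValue T * ‖x‖ := by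
  have hpos : 0 < Module.finrank ℝ E := Module.finrank_pos
  refine ⟨rightSingularBasis T ⟨0, hpos⟩, by simp, ?_, fun x hx => ?_⟩
  · rw [norm_apply_rightSingularBasis]
    exact singularValues_zero_eq_norm T
  · refine le_of_sq_le_sq ?_ (mul_nonneg (secondSingularValue_nonneg T) (norm_nonneg _))
    rw [norm_apply_sq_eq_sum, mul_pow, norm_sq_eq_sum_rightSingularBasis T x, Finset.mul_sum]
    refine Finset.sum_le_sum fun i _ => ?_
    by_cases hi : i = ⟨0, hpos⟩
    · rw [hi, hx]; simp
    · have h1 : 1 ≤ (i : ℕ) := by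
        rcases Nat.eq_zero_or_pos (i : ℕ) with h | h
        · exact absurd (Fin.ext h) hi
        · exact h
      gcongr
      · exact LinearMap.singularValues_nonneg _ _
      · exact LinearMap.singularValues_antitone _ h1

/-- If an operator maps the unit ball within distance `t` of a line, then its second singular value
is at most `t`. -/
lemma secondSingularValue_le_of_near_line (T : E →L[ℝ] E) (p : E) {t : ℝ} (ht : 0 ≤ t)
    (h : ∀ y, ‖y‖ ≤ 1 → ∃ a : ℝ, ‖T y - a • p‖ ≤ t) : secondSingularValue T ≤ t := by
  by_cases hd : Module.finrank ℝ E ≤ 1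
  · rw [secondSingularValue, LinearMap.singularValues_of_finrank_le _ hd]; exact ht
  push Not at hd
  set b := rightSingularBasis T
  set i0 : Fin (Module.finrank ℝ E) := ⟨0, by omega⟩
  set i1 : Fin (Module.finrank ℝ E) := ⟨1, hd⟩
  have h01 : i0 ≠ i1 := by simp [i0, i1]
  -- a nonzero vector of the top singular plane whose image is orthogonal to `p`
  obtain ⟨a0, a1, hne, horth⟩ : ∃ a0 a1 : ℝ, a0 ^ 2 + a1 ^ 2 = 1 ∧
      inner ℝ p (T (a0 • b i0 + a1 • b i1)) = 0 := by
    set α := inner ℝ p (T (b i0))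
    set β := inner ℝ p (T (b i1))
    by_cases hz : α ^ 2 + β ^ 2 = 0
    · have hα : α = 0 := by nlinarith [sq_nonneg α, sq_nonneg β]
      refine ⟨1, 0, by norm_num, ?_⟩
      simpa using hα
    · have hs : 0 < α ^ 2 + β ^ 2 := lt_of_le_of_ne (by positivity) (Ne.symm hz)
      refine ⟨β / √(α ^ 2 + β ^ 2), -α / √(α ^ 2 + β ^ 2), ?_, ?_⟩
      · rw [div_pow, div_pow, Real.sq_sqrt hs.le]
        field_simp
        ring
      · simp only [map_add, map_smul, inner_add_right, inner_smul_right]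
        change _ * α + _ * β = 0
        ring
  set y := a0 • b i0 + a1 • b i1
  have hin0 : inner ℝ (b i0) y = a0 := by
    simp [y, inner_add_right, inner_smul_right, h01]
  have hin1 : inner ℝ (b i1) y = a1 := by
    simp [y, inner_add_right, inner_smul_right, h01.symm]
  have hother : ∀ i, i ≠ i0 → i ≠ i1 → inner ℝ (b i) y = 0 := by
    intro i h0 h1
    simp [y, inner_add_right, inner_smul_right, h0, h1]
  have hsum : ∀ f : Fin (Module.finrank ℝ E) → ℝ,
      ∑ i, f i * inner ℝ (b i) y ^ 2 = f i0 * a0 ^ 2 + f i1 * a1 ^ 2 := by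
    intro f
    rw [Finset.sum_eq_add (s := Finset.univ) (f := fun i => f i * inner ℝ (b i) y ^ 2) i0 i1 h01
      (fun i _ hi => by simp only [hother i hi.1 hi.2]; simp) (by simp) (by simp), hin0, hin1]
  have hy1 : ‖y‖ ^ 2 = 1 := by
    rw [norm_sq_eq_sum_rightSingularBasis T y]
    simpa [hne] using hsum fun _ => 1
  have hlow : secondSingularValue T ^ 2 ≤ ‖T y‖ ^ 2 := by
    rw [norm_apply_sq_eq_sum, hsum]
    have e1 : secondSingularValue T ^ 2 ≤ (T : E →ₗ[ℝ] E).singularValues i0 ^ 2 := by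
      gcongr
      · exact secondSingularValue_nonneg T
      · exact LinearMap.singularValues_antitone _ (Nat.zero_le _)
    have e2 : (T : E →ₗ[ℝ] E).singularValues i1 = secondSingularValue T := rfl
    rw [e2]
    nlinarith [sq_nonneg a0, sq_nonneg a1]
  obtain ⟨a, ha⟩ := h y (by nlinarith [norm_nonneg y])
  -- `T y` is orthogonal to `p`, so `0` is the point of the line closest to it.
  have hT : ‖T y‖ ≤ ‖T y - a • p‖ := by
    refine le_of_sq_le_sq ?_ (norm_nonneg _)
    rw [norm_sub_sq_real, inner_smul_right, real_inner_comm, horth]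
    nlinarith [sq_nonneg ‖a • p‖]
  exact (le_of_sq_le_sq hlow (norm_nonneg _)).trans (hT.trans ha)

end SingularValues

/-! ### Bivectors and their growth under operators. -/

section Wedge

variable {E : Type*} [NormedAddCommGroup E] [InnerProductSpace ℝ E]

/-- The bivector `x ∧ y`, realized as the skew operator `z ↦ ⟪x, z⟫ y - ⟪y, z⟫ x`. -/
noncomputable def wedge (x y : E) : E →L[ℝ] E :=
  (innerSL ℝ x).smulRight y - (innerSL ℝ y).smulRight x

lemma wedge_apply (x y z : E) : wedge x y z = inner ℝ x z • y - inner ℝ y z • x := by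
  simp [wedge]

lemma wedge_self (x : E) : wedge x x = 0 := by simp [wedge]

lemma wedge_add_right (x y z : E) : wedge x (y + z) = wedge x y + wedge x z := by
  ext t; simp only [wedge_apply, add_apply, inner_add_left]; module

lemma wedge_add_left (x y z : E) : wedge (x + y) z = wedge x z + wedge y z := by
  ext t; simp only [wedge_apply, add_apply, inner_add_left]; module

lemma wedge_smul_right (a : ℝ) (x y : E) : wedge x (a • y) = a • wedge x y := by
  ext t; simp only [wedge_apply, smul_apply, real_inner_smul_left]; module

lemma wedge_smul_left (a : ℝ) (x y : E) : wedge (a • x) y = a • wedge x y := by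
  ext t; simp only [wedge_apply, smul_apply, real_inner_smul_left]; module

lemma norm_wedge_le (x y : E) : ‖wedge x y‖ ≤ 2 * ‖x‖ * ‖y‖ := by
  refine (norm_sub_le _ _).trans (le_of_eq ?_)
  rw [ContinuousLinearMap.norm_smulRight_apply, ContinuousLinearMap.norm_smulRight_apply,
    innerSL_apply_norm, innerSL_apply_norm]
  ring

lemma continuous_wedge_right (x : E) : Continuous fun y => wedge x y :=
  (LinearMap.mkContinuous
    { toFun := fun y => wedge x y
      map_add' := wedge_add_right x
      map_smul' := fun (a : ℝ) y => wedge_smul_right a x y : E →ₗ[ℝ] E →L[ℝ] E } (2 * ‖x‖) (norm_wedge_le x)).continuous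

/-- The skew operator evaluated at `x` itself returns the component of `y` orthogonal to `x`. -/
lemma norm_sub_inner_smul_le_norm_wedge {x : E} (hx : ‖x‖ = 1) (y : E) :
    ‖y - inner ℝ x y • x‖ ≤ ‖wedge x y‖ := by
  have h := (wedge x y).le_opNorm x
  rwa [wedge_apply, real_inner_self_eq_norm_sq, hx, one_pow, one_smul, mul_one,
    real_inner_comm] at h

lemma exists_decomposition_of_norm_eq_one {v : E} (hv : ‖v‖ = 1) (x : E) :
    ∃ (a : ℝ) (b : E), x = a • v + b ∧ inner ℝ v b = 0 ∧ |a| ≤ ‖x‖ ∧ ‖b‖ ≤ ‖x‖ := by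
  have horth : inner ℝ v (x - inner ℝ v x • v) = 0 := by
    rw [inner_sub_right, inner_smul_right, real_inner_self_eq_norm_sq, hv]; ring
  refine ⟨inner ℝ v x, x - inner ℝ v x • v, by abel, horth, ?_, ?_⟩
  · simpa [hv] using abs_real_inner_le_norm v x
  · refine le_of_sq_le_sq ?_ (norm_nonneg _)
    have h := norm_sub_sq_real x (inner ℝ v x • v)
    rw [inner_smul_right, real_inner_comm v x, norm_smul, hv, mul_one, Real.norm_eq_abs, sq_abs] at h
    nlinarith [sq_nonneg (inner ℝ v x)]

variable [FiniteDimensional ℝ E]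

lemma secondSingularValue_le_norm [Nontrivial E] (T : E →L[ℝ] E) :
    secondSingularValue T ≤ ‖T‖ := by
  rw [← singularValues_zero_eq_norm]
  exact LinearMap.singularValues_antitone _ (Nat.zero_le _)

/-- Up to the second singular value, the norm of a product is seen on a top singular vector. -/
lemma norm_mul_le_norm_apply_add [Nontrivial E] (A R : E →L[ℝ] E) {v : E} (hv : ‖v‖ = 1)
    (hperp : ∀ x, inner ℝ v x = 0 → ‖R x‖ ≤ secondSingularValue R * ‖x‖) :
    ‖A * R‖ ≤ ‖A (R v)‖ + ‖A‖ * secondSingularValue R := by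
  obtain ⟨z, hz, hARz, -⟩ := exists_top_singular_vector (A * R)
  obtain ⟨p, q, hpq, hvq, hp, hq⟩ := exists_decomposition_of_norm_eq_one hv z
  rw [← hARz, mul_apply_eq_comp, hpq, map_add, map_add, map_smul, map_smul]
  rw [hz] at hp hq
  refine (norm_add_le _ _).trans ?_
  rw [norm_smul, Real.norm_eq_abs]
  have hs := secondSingularValue_nonneg R
  have : ‖A (R q)‖ ≤ ‖A‖ * secondSingularValue R := by
    refine (A.le_opNorm _).trans ?_
    gcongr
    refine (hperp q hvq).trans ?_
    nlinarith
  nlinarith [norm_nonneg (A (R v))]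

/-- Split both vectors along the top singular vector `v`. The `Tv ∧ Tv` term vanishes, so each of
the three remaining terms has a factor from the complement of `v`, where `T` is bounded by its
second singular value; each contributes `2`. -/
lemma norm_wedge_map_le [Nontrivial E] (T : E →L[ℝ] E) (x y : E) :
    ‖wedge (T x) (T y)‖ ≤ 6 * ‖T‖ * secondSingularValue T * ‖x‖ * ‖y‖ := by
  obtain ⟨v, hv, hTv, hT⟩ := exists_top_singular_vector T
  obtain ⟨a, b, hx, hvb, ha, hb⟩ := exists_decomposition_of_norm_eq_one hv x
  obtain ⟨a', b', hy, hvb', ha', hb'⟩ := exists_decomposition_of_norm_eq_one hv y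
  have hs := secondSingularValue_nonneg T
  have hs' := secondSingularValue_le_norm T
  set s := secondSingularValue T
  have e : wedge (T x) (T y) =
      a • wedge (T v) (T b') + a' • wedge (T b) (T v) + wedge (T b) (T b') := by
    rw [hx, hy]
    simp only [map_add, map_smul, wedge_add_left, wedge_add_right, wedge_smul_left,
      wedge_smul_right, wedge_self, smul_zero, smul_add]
    abel
  have h1 : ‖a • wedge (T v) (T b')‖ ≤ ‖x‖ * (2 * ‖T‖ * (s * ‖y‖)) := by
    rw [norm_smul, Real.norm_eq_abs]
    have := norm_wedge_le (T v) (T b')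
    rw [hTv] at this
    gcongr
    refine this.trans ?_
    gcongr
    exact (hT b' hvb').trans (by gcongr)
  have h2 : ‖a' • wedge (T b) (T v)‖ ≤ ‖y‖ * (2 * (s * ‖x‖) * ‖T‖) := by
    rw [norm_smul, Real.norm_eq_abs]
    have := norm_wedge_le (T b) (T v)
    rw [hTv] at this
    gcongr
    refine this.trans ?_
    gcongr
    exact (hT b hvb).trans (by gcongr)
  have h3 : ‖wedge (T b) (T b')‖ ≤ 2 * (‖T‖ * ‖x‖) * (s * ‖y‖) := by
    refine (norm_wedge_le _ _).trans ?_
    gcongr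
    · exact (T.le_opNorm b).trans (by gcongr)
    · exact (hT b' hvb').trans (by gcongr)
  rw [e]
  calc _ ≤ _ := norm_add₃_le
    _ ≤ _ := add_le_add (add_le_add h1 h2) h3
    _ = _ := by ring

end Wedge

/-! ### Quasi-multiplicativity of norms of dominated products. -/

section QuasiMultiplicativity

variable {E : Type*} [NormedAddCommGroup E] [InnerProductSpace ℝ E] [FiniteDimensional ℝ E]

/-- Almost supermultiplicativity of the norm when the middle factor has a small second singular
value. -/
lemma norm_mul_mul_ge [Nontrivial E] {A A' R B B' : E →L[ℝ] E} {M D : ℝ}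
    (hA : ‖A‖ ≤ M) (hA' : ‖A'‖ ≤ M) (hAA : A' * A = 1) (hB : ‖B‖ ≤ M) (hB' : ‖B'‖ ≤ M)
    (hBB : B * B' = 1) (hM : 1 ≤ M) (hD : 0 ≤ D) (hR : secondSingularValue R ≤ D * ‖R‖) :
    (1 - 3 * M ^ 4 * D) * (‖A * R‖ * ‖R * B‖) ≤ ‖A * R * B‖ * ‖R‖ := by
  have hRA : ‖R‖ ≤ M * ‖A * R‖ := by
    calc ‖R‖ = ‖A' * (A * R)‖ := by rw [← mul_assoc, hAA, one_mul]
      _ ≤ ‖A'‖ * ‖A * R‖ := norm_mul_le _ _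
      _ ≤ _ := by gcongr
  have hRB : ‖R‖ ≤ M * ‖R * B‖ := by
    calc ‖R‖ = ‖(R * B) * B'‖ := by rw [mul_assoc, hBB, mul_one]
      _ ≤ ‖R * B‖ * ‖B'‖ := norm_mul_le _ _
      _ ≤ ‖R * B‖ * M := by gcongr
      _ = _ := mul_comm _ _
  have hM2 : 1 ≤ M ^ 2 := one_le_pow₀ hM
  have hM4 : M ^ 2 ≤ M ^ 4 := pow_le_pow_right₀ hM (by norm_num)
  -- Here the factor on the left is nonpositive. In the other case `1 - D * M ^ 2` is positive,
  -- which is needed to multiply `h4` and `h5`.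
  by_cases hlarge : 1 ≤ D * M ^ 2
  · have : 1 - 3 * M ^ 4 * D ≤ 0 := by nlinarith
    exact (mul_nonpos_of_nonpos_of_nonneg this (by positivity)).trans (by positivity)
  push Not at hlarge
  obtain ⟨v, hv, hRv, hperp⟩ := exists_top_singular_vector R
  obtain ⟨x, hx, hRBx, -⟩ := exists_top_singular_vector (R * B)
  obtain ⟨a, b, hBx, hvb, -, hb⟩ := exists_decomposition_of_norm_eq_one hv (B x)
  set s := secondSingularValue R
  have hs : 0 ≤ s := secondSingularValue_nonneg R
  have hbM : ‖b‖ ≤ M := hb.trans ((B.le_opNorm x).trans (by rw [hx, mul_one]; exact hB))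
  have hRb : ‖R b‖ ≤ D * ‖R‖ * M :=
    (hperp b hvb).trans (by gcongr)
  have h1 : ‖R * B‖ ≤ |a| * ‖R‖ + D * ‖R‖ * M := by
    rw [← hRBx, mul_apply_eq_comp, hBx, map_add, map_smul]
    refine (norm_add_le _ _).trans ?_
    rw [norm_smul, hRv, Real.norm_eq_abs]
    gcongr
  have h2 : ‖A * R‖ ≤ ‖A (R v)‖ + M * (D * ‖R‖) := by
    refine (norm_mul_le_norm_apply_add A R hv hperp).trans ?_
    gcongr
  have h3 : |a| * ‖A (R v)‖ ≤ ‖A * R * B‖ + M * (D * ‖R‖ * M) := by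
    have e : (A * R * B) x = a • A (R v) + A (R b) := by
      simp only [mul_apply_eq_comp]
      rw [hBx, map_add, map_add, map_smul, map_smul]
    have e1 : ‖(A * R * B) x‖ ≤ ‖A * R * B‖ := by
      simpa [hx] using (A * R * B).le_opNorm x
    have e2 : ‖A (R b)‖ ≤ M * (D * ‖R‖ * M) := (A.le_opNorm _).trans (by gcongr)
    have e3 : |a| * ‖A (R v)‖ = ‖(A * R * B) x - A (R b)‖ := by
      rw [e, add_sub_cancel_right, norm_smul, Real.norm_eq_abs]
    rw [e3]
    exact (norm_sub_le _ _).trans (add_le_add e1 e2)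
  set X := ‖A * R‖
  set Y := ‖R * B‖
  set ρ := ‖R‖
  have hX : 0 ≤ X := norm_nonneg _
  have hY : 0 ≤ Y := norm_nonneg _
  have hρ : 0 ≤ ρ := norm_nonneg _
  have h4 : (1 - D * M ^ 2) * Y ≤ |a| * ρ := by
    have : D * ρ * M ≤ D * (M * Y) * M := by gcongr
    linarith
  have h5 : (1 - D * M ^ 2) * X ≤ ‖A (R v)‖ := by
    have : M * (D * ρ) ≤ M * (D * (M * X)) := by gcongr
    linarith
  have h6 : ((1 - D * M ^ 2) * Y) * ((1 - D * M ^ 2) * X) ≤ (|a| * ρ) * ‖A (R v)‖ := by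
    have : 0 ≤ 1 - D * M ^ 2 := by linarith
    gcongr
  have h7 : (|a| * ‖A (R v)‖) * ρ ≤ (‖A * R * B‖ + M * (D * ρ * M)) * ρ := by gcongr
  have h8 : D * M ^ 2 * (ρ * ρ) ≤ D * M ^ 2 * ((M * X) * (M * Y)) := by gcongr
  have h9 : D * M ^ 2 * (X * Y) ≤ D * M ^ 4 * (X * Y) := by gcongr
  have h10 : 0 ≤ (D * M ^ 2) ^ 2 * (X * Y) := by positivity
  -- With `X = ‖A * R‖` and `Y = ‖R * B‖`, the losses are `2 * D * M ^ 2` from the square in `h6`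
  -- and `D * M ^ 4` from `h7` and `h8`, together at most `3 * D * M ^ 4`.
  nlinarith

/-- Data of a uniformly bounded family of invertible operators with uniformly dominated products. -/
structure UniformlyDominated (S : Set (E →L[ℝ] E)) (C r M : ℝ) : Prop where
  one_le_C : 1 ≤ C
  one_le_M : 1 ≤ M
  r_pos : 0 < r
  r_lt_one : r < 1
  norm_le : ∀ A ∈ S, ‖A‖ ≤ M
  exists_inv : ∀ A ∈ S, ∃ A', A' * A = 1 ∧ A * A' = 1 ∧ ‖A'‖ ≤ M
  dominated : ∀ w : List (E →L[ℝ] E), (∀ A ∈ w, A ∈ S) →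
    secondSingularValue w.prod ≤ C * r ^ w.length * ‖w.prod‖

namespace UniformlyDominated

variable {S : Set (E →L[ℝ] E)} {C r M : ℝ}

lemma isUnit_prod (h : UniformlyDominated S C r M) :
    ∀ w : List (E →L[ℝ] E), (∀ A ∈ w, A ∈ S) → IsUnit w.prod
  | [], _ => by simp
  | A :: w, hw => by
    rw [List.prod_cons]
    obtain ⟨A', h1, h2, -⟩ := h.exists_inv A (hw A (by simp))
    exact IsUnit.mul ⟨⟨A, A', h2, h1⟩, rfl⟩ (h.isUnit_prod w fun B hB => hw B (by simp [hB]))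

lemma norm_prod_pos [Nontrivial E] (h : UniformlyDominated S C r M) (w : List (E →L[ℝ] E))
    (hw : ∀ A ∈ w, A ∈ S) : 0 < ‖w.prod‖ :=
  norm_pos_iff.2 (h.isUnit_prod w hw).ne_zero

/-- Exponentials turn a product of losses along a word into a geometric sum. With `t = 3 * M ^ 4 * C
* r ^ n`, the inequality `exp (-2t) ≤ 1 - t` serves for `t ≤ 1/2`; for larger `t` the extra factor
`1 + 4 * log M` brings the exponential below `M⁻⁴`. -/
lemma exists_exp_bound (h : UniformlyDominated S C r M) : ∃ K : ℝ, 0 ≤ K ∧ ∀ n : ℕ,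
    Real.exp (-(K * r ^ n)) ≤ max (1 - 3 * M ^ 4 * (C * r ^ n)) ((M ^ 4)⁻¹) := by
  have hM := h.one_le_M
  have hC := h.one_le_C
  have hr := h.r_pos
  have hlog : 0 ≤ Real.log M := Real.log_nonneg hM
  refine ⟨6 * M ^ 4 * C * (1 + 4 * Real.log M), by positivity, fun n => ?_⟩
  set t := 3 * M ^ 4 * (C * r ^ n) with ht
  have htpos : 0 < t := by positivity
  have e : 6 * M ^ 4 * C * (1 + 4 * Real.log M) * r ^ n = 2 * t * (1 + 4 * Real.log M) := by
    rw [ht]; ring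
  rw [e]
  rcases le_or_gt t (1 / 2) with hle | hgt
  · refine le_max_of_le_left ?_
    rw [← Real.le_log_iff_exp_le (by linarith)]
    have h1 := Real.one_sub_inv_le_log_of_pos (show 0 < 1 - t by linarith)
    have h2 : (1 - t)⁻¹ ≤ 1 + 2 * t := by
      rw [inv_le_iff_one_le_mul₀ (by linarith)]
      nlinarith
    nlinarith [mul_nonneg htpos.le hlog]
  · refine le_max_of_le_right ?_
    rw [← Real.le_log_iff_exp_le (by positivity), Real.log_inv, Real.log_pow]
    push_cast
    nlinarith

/-- `norm_mul_mul_ge` is informative only for long middle words; for short ones the bounds on `A`,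
`B` and their inverses give the factor `M⁻⁴`. -/
lemma exists_triple_bound [Nontrivial E] (h : UniformlyDominated S C r M) : ∃ K : ℝ, 0 ≤ K ∧
    ∀ A ∈ S, ∀ B ∈ S, ∀ w : List (E →L[ℝ] E), (∀ A ∈ w, A ∈ S) →
      Real.exp (-(K * r ^ w.length)) * (‖A * w.prod‖ * ‖w.prod * B‖) ≤
        ‖A * w.prod * B‖ * ‖w.prod‖ := by
  obtain ⟨K, hK, hexp⟩ := h.exists_exp_bound
  have hM := h.one_le_M
  have hC := h.one_le_C
  have hr := h.r_pos
  refine ⟨K, hK, fun A hA B hB w hw => ?_⟩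
  obtain ⟨A', hA1, -, hA3⟩ := h.exists_inv A hA
  obtain ⟨B', -, hB2, hB3⟩ := h.exists_inv B hB
  have hAM := h.norm_le A hA
  have hBM := h.norm_le B hB
  have h1 := norm_mul_mul_ge hAM hA3 hA1 hBM hB3 hB2 hM (D := C * r ^ w.length)
    (by positivity) (h.dominated w hw)
  set R := w.prod
  refine (mul_le_mul_of_nonneg_right (hexp w.length) (by positivity)).trans ?_
  rcases max_choice (1 - 3 * M ^ 4 * (C * r ^ w.length)) ((M ^ 4)⁻¹) with he | he <;> rw [he]
  · exact h1
  · have e1 : ‖A * R‖ ≤ M * ‖R‖ := (norm_mul_le _ _).trans (by gcongr)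
    have e2 : ‖R * B‖ ≤ ‖R‖ * M := (norm_mul_le _ _).trans (by gcongr)
    have e3 : ‖R‖ ≤ M * ‖A * R * B‖ * M := by
      calc ‖R‖ = ‖A' * (A * R * B) * B'‖ := by
            congr 1
            calc R = (A' * A) * R * (B * B') := by rw [hA1, hB2, one_mul, mul_one]
              _ = _ := by simp only [mul_assoc]
        _ ≤ ‖A' * (A * R * B)‖ * ‖B'‖ := norm_mul_le _ _
        _ ≤ (‖A'‖ * ‖A * R * B‖) * ‖B'‖ := by gcongr; exact norm_mul_le _ _
        _ ≤ _ := by gcongr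
    rw [inv_mul_le_iff₀ (by positivity)]
    calc ‖A * R‖ * ‖R * B‖ ≤ (M * ‖R‖) * (‖R‖ * M) := by gcongr
      _ ≤ (M * (M * ‖A * R * B‖ * M)) * (‖R‖ * M) := by gcongr
      _ = _ := by ring

/-- Norms of products of dominated operators are multiplicative up to a uniform constant. -/
lemma exists_quasiMultiplicative [Nontrivial E] (h : UniformlyDominated S C r M) :
    ∃ c : ℝ, 0 < c ∧ ∀ w z : List (E →L[ℝ] E), (∀ A ∈ w, A ∈ S) → (∀ A ∈ z, A ∈ S) →
      c * (‖w.prod‖ * ‖z.prod‖) ≤ ‖w.prod * z.prod‖ := by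
  obtain ⟨K, hK, htriple⟩ := h.exists_triple_bound
  have hr := h.r_pos
  have hr1 : 0 < 1 - r := by linarith [h.r_lt_one]
  -- `L` is the fixed point of `L = K + L * r`, which closes the induction in `step1`.
  set L := K / (1 - r) with hL
  have hLK : L = K + L * r := by rw [hL]; field_simp; ring
  have hL0 : 0 ≤ L := by positivity
  -- The right factor of the triple bound becomes an arbitrary word: its first letter is moved to
  -- the end of the middle word, so the losses form a geometric series.
  have step1 : ∀ z : List (E →L[ℝ] E), (∀ A ∈ z, A ∈ S) → ∀ w : List (E →L[ℝ] E),
      (∀ A ∈ w, A ∈ S) → ∀ A ∈ S, Real.exp (-(L * r ^ w.length)) *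
        (‖A * w.prod‖ * ‖w.prod * z.prod‖) ≤ ‖A * w.prod * z.prod‖ * ‖w.prod‖ := by
    intro z
    induction z with
    | nil =>
      intro _ w hw A hA
      simp only [List.prod_nil, mul_one]
      exact mul_le_of_le_one_left (by positivity) (Real.exp_le_one_iff.2 (by
        have : 0 ≤ L * r ^ w.length := by positivity
        linarith))
    | cons B z ih =>
      intro hz w hw A hA
      have hB : B ∈ S := hz B (by simp)
      have hwB : ∀ D ∈ w ++ [B], D ∈ S := by
        intro D hD
        rcases List.mem_append.1 hD with hD | hD
        · exact hw D hD
        · rw [List.mem_singleton.1 hD]; exact hB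
      have h1 := ih (fun D hD => hz D (by simp [hD])) (w ++ [B]) hwB A hA
      have h2 := htriple A hA B hB w hw
      have hpos := h.norm_prod_pos (w ++ [B]) hwB
      simp only [List.prod_append, List.prod_singleton, List.length_append,
        List.length_singleton] at h1 hpos
      rw [List.prod_cons]
      have e : Real.exp (-(L * r ^ w.length)) =
          Real.exp (-(L * r ^ (w.length + 1))) * Real.exp (-(K * r ^ w.length)) := by
        rw [← Real.exp_add]; congr 1
        have : L * r ^ w.length = (K + L * r) * r ^ w.length := by rw [← hLK]
        rw [this]; ring
      rw [e]
      simp only [← mul_assoc] at h1 h2 ⊢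
      set e1 := Real.exp (-(L * r ^ (w.length + 1)))
      set e0 := Real.exp (-(K * r ^ w.length))
      have he1 : 0 < e1 := Real.exp_pos _
      refine le_of_mul_le_mul_right ?_ hpos
      calc _ = e1 * ‖w.prod * B * z.prod‖ * (e0 * ‖A * w.prod‖ * ‖w.prod * B‖) := by ring
        _ ≤ e1 * ‖w.prod * B * z.prod‖ * (‖A * w.prod * B‖ * ‖w.prod‖) := by gcongr
        _ = (e1 * ‖A * w.prod * B‖ * ‖w.prod * B * z.prod‖) * ‖w.prod‖ := by ring
        _ ≤ (‖A * w.prod * B * z.prod‖ * ‖w.prod * B‖) * ‖w.prod‖ := by gcongr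
        _ = _ := by ring
  -- Building `w` from the right costs `L * r ^ k` in the exponent at length `k`; the sum stays
  -- below `L / (1 - r)`.
  have step2 : ∀ z : List (E →L[ℝ] E), (∀ A ∈ z, A ∈ S) → ∀ w : List (E →L[ℝ] E),
      (∀ A ∈ w, A ∈ S) → Real.exp (-(L * ((1 - r ^ w.length) / (1 - r)))) *
        (‖w.prod‖ * ‖z.prod‖) ≤ ‖w.prod * z.prod‖ := by
    intro z hz w
    induction w with
    | nil => intro _; simp
    | cons A w ih =>
      intro hw
      have hA : A ∈ S := hw A (by simp)
      have hw' : ∀ D ∈ w, D ∈ S := fun D hD => hw D (by simp [hD])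
      have h1 := ih hw'
      have h2 := step1 z hz w hw' A hA
      have hpos := h.norm_prod_pos w hw'
      have e : Real.exp (-(L * ((1 - r ^ (A :: w).length) / (1 - r)))) =
          Real.exp (-(L * ((1 - r ^ w.length) / (1 - r)))) *
            Real.exp (-(L * r ^ w.length)) := by
        rw [← Real.exp_add, List.length_cons]; congr 1
        field_simp
        ring
      rw [e, List.prod_cons]
      set e1 := Real.exp (-(L * ((1 - r ^ w.length) / (1 - r))))
      set e0 := Real.exp (-(L * r ^ w.length))
      have he0 : 0 < e0 := Real.exp_pos _
      refine le_of_mul_le_mul_right ?_ hpos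
      calc _ = e0 * (‖A * w.prod‖ * (e1 * (‖w.prod‖ * ‖z.prod‖))) := by ring
        _ ≤ e0 * (‖A * w.prod‖ * ‖w.prod * z.prod‖) := by gcongr
        _ ≤ _ := h2
  refine ⟨Real.exp (-(L * (1 / (1 - r)))), Real.exp_pos _, fun w z hw hz => ?_⟩
  refine le_trans ?_ (step2 z hz w hw)
  gcongr
  have : 0 ≤ r ^ w.length := by positivity
  linarith

end UniformlyDominated

end QuasiMultiplicativity

/-! ### Invariant cones, possibly overlapping, from domination. -/

section DominatedCones

variable {E : Type*} [NormedAddCommGroup E] [InnerProductSpace ℝ E]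

/-- A finite family of uniformly acute closed convex cones that is strictly preserved, up to signs,
by every operator of `S`. Distinct cones are allowed to overlap. -/
structure IsPreMulticone {ι : Type*} (S : Set (E →L[ℝ] E)) (K : ι → Set E) (w : E) (κ : ℝ) :
    Prop where
  isClosed : ∀ j, IsClosed (K j)
  add_mem : ∀ j, ∀ x ∈ K j, ∀ y ∈ K j, x + y ∈ K j
  smul_mem : ∀ j, ∀ a : ℝ, 0 ≤ a → ∀ x ∈ K j, a • x ∈ K j
  interior_nonempty : ∀ j, (interior (K j)).Nonempty
  kappa_pos : 0 < κ
  transverse : ∀ j, ∀ x ∈ K j, κ * ‖x‖ ≤ inner ℝ w x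
  mapsTo : ∀ A ∈ S, ∀ j, ∃ l, ∃ s : ℝ, (s = 1 ∨ s = -1) ∧
    ∀ x ∈ K j, x ≠ 0 → s • A x ∈ interior (K l)

/-- A vector whose norm is expanded by every product of elements of `S` at a rate comparable to the
norm of the product. -/
def IsExpanded (S : Set (E →L[ℝ] E)) (ε : ℝ) (u : E) : Prop :=
  ∀ w : List (E →L[ℝ] E), (∀ A ∈ w, A ∈ S) → ε * (‖w.prod‖ * ‖u‖) ≤ ‖w.prod u‖

lemma IsExpanded.smul {S : Set (E →L[ℝ] E)} {ε : ℝ} {u : E} (h : IsExpanded S ε u) (a : ℝ) :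
    IsExpanded S ε (a • u) := by
  intro w hw
  rw [map_smul, norm_smul, norm_smul]
  calc _ = ‖a‖ * (ε * (‖w.prod‖ * ‖u‖)) := by ring
    _ ≤ _ := by gcongr; exact h w hw

/-- The cone of vectors whose images under products stay exponentially close to those of `u`. -/
def dominatedCone (S : Set (E →L[ℝ] E)) (r δ : ℝ) (u : E) : Set E :=
  {y | ∀ w : List (E →L[ℝ] E), (∀ A ∈ w, A ∈ S) →
    ‖wedge (w.prod u) (w.prod y)‖ * ‖u‖ ^ 2 ≤ δ * r ^ w.length * ‖w.prod u‖ ^ 2 * inner ℝ u y}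

variable {S : Set (E →L[ℝ] E)} {C r M δ δ' ε η : ℝ} {u u' y : E}

lemma isClosed_dominatedCone : IsClosed (dominatedCone S r δ u) := by
  simp only [dominatedCone, Set.ofPred_forall]
  refine isClosed_iInter fun w => isClosed_iInter fun _ => isClosed_le ?_ ?_
  · exact ((continuous_wedge_right _).comp w.prod.continuous).norm.mul continuous_const
  · fun_prop

lemma add_mem_dominatedCone {x : E} (hx : x ∈ dominatedCone S r δ u)
    (hy : y ∈ dominatedCone S r δ u) : x + y ∈ dominatedCone S r δ u := by
  intro w hw
  rw [map_add, wedge_add_right, inner_add_right, mul_add]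
  refine le_trans ?_ (add_le_add (hx w hw) (hy w hw))
  rw [← add_mul]
  gcongr
  exact norm_add_le _ _

lemma smul_mem_dominatedCone {a : ℝ} (ha : 0 ≤ a) (hy : y ∈ dominatedCone S r δ u) :
    a • y ∈ dominatedCone S r δ u := by
  intro w hw
  rw [map_smul, wedge_smul_right, inner_smul_right, norm_smul, Real.norm_of_nonneg ha]
  calc _ = a * (‖wedge (w.prod u) (w.prod y)‖ * ‖u‖ ^ 2) := by ring
    _ ≤ a * _ := mul_le_mul_of_nonneg_left (hy w hw) ha
    _ = _ := by ring

lemma dominatedCone_smul {a : ℝ} (ha : 0 < a) :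
    dominatedCone S r δ (a • u) = dominatedCone S r δ u := by
  ext y
  refine forall₂_congr fun w hw => ?_
  rw [map_smul, wedge_smul_left, real_inner_smul_left, norm_smul, norm_smul, norm_smul,
    Real.norm_of_nonneg ha.le, ← mul_le_mul_iff_right₀ (show 0 < a ^ 3 by positivity)
      (b := ‖wedge (w.prod u) (w.prod y)‖ * ‖u‖ ^ 2)]
  refine iff_of_eq (congrArg₂ _ ?_ ?_) <;> ring

lemma neg_mem_dominatedCone_neg (hy : y ∈ dominatedCone S r δ u) :
    -y ∈ dominatedCone S r δ (-u) := by
  intro w hw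
  have h := hy w hw
  rw [map_neg, map_neg, ← neg_one_smul ℝ (w.prod u), ← neg_one_smul ℝ (w.prod y),
    wedge_smul_left, wedge_smul_right]
  simpa using h

/-- The empty word in the definition already places `y` in a round cone about `u`. -/
lemma norm_sub_inner_smul_le_of_mem_dominatedCone (hu : ‖u‖ = 1)
    (hy : y ∈ dominatedCone S r δ u) : ‖y - inner ℝ u y • u‖ ≤ δ * inner ℝ u y := by
  refine (norm_sub_inner_smul_le_norm_wedge hu y).trans ?_
  simpa [hu] using hy [] (by simp)

lemma inner_pos_of_mem_dominatedCone (hu : ‖u‖ = 1) (hδ : 0 < δ)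
    (hy : y ∈ dominatedCone S r δ u) (hy0 : y ≠ 0) : 0 < inner ℝ u y := by
  have h := norm_sub_inner_smul_le_of_mem_dominatedCone hu hy
  have h0 : 0 ≤ inner ℝ u y := nonneg_of_mul_nonneg_right ((norm_nonneg _).trans h) hδ
  refine lt_of_le_of_ne h0 fun he => hy0 ?_
  rw [← he, zero_smul, sub_zero, mul_zero] at h
  exact norm_le_zero_iff.1 h

lemma norm_le_of_mem_dominatedCone (hu : ‖u‖ = 1) (hδ : 0 < δ) (hδ1 : δ ≤ 1)
    (hy : y ∈ dominatedCone S r δ u) : ‖y‖ ≤ 2 * inner ℝ u y := by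
  have h := norm_sub_inner_smul_le_of_mem_dominatedCone hu hy
  have h0 : 0 ≤ inner ℝ u y := nonneg_of_mul_nonneg_right ((norm_nonneg _).trans h) hδ
  have h1 : ‖y‖ ≤ ‖y - inner ℝ u y • u‖ + ‖inner ℝ u y • u‖ := by
    simpa using norm_add_le (y - inner ℝ u y • u) (inner ℝ u y • u)
  rw [norm_smul, hu, mul_one, Real.norm_of_nonneg h0] at h1
  nlinarith

lemma self_mem_dominatedCone (hr : 0 ≤ r) (hδ : 0 ≤ δ) : u ∈ dominatedCone S r δ u := by
  intro w hw
  rw [wedge_self, norm_zero, zero_mul, real_inner_self_eq_norm_sq]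
  positivity

lemma transverse_of_mem_dominatedCone {w : E} (hw : ‖w‖ = 1) (hu : ‖u‖ = 1) (hδ : 0 < δ)
    (hδ1 : δ ≤ 1) (hε : 2 * δ ≤ ε) (hwu : ε ≤ inner ℝ w u)
    (hy : y ∈ dominatedCone S r δ u) : ε / 4 * ‖y‖ ≤ inner ℝ w y := by
  have h := norm_sub_inner_smul_le_of_mem_dominatedCone hu hy
  have h0 : 0 ≤ inner ℝ u y := nonneg_of_mul_nonneg_right ((norm_nonneg _).trans h) hδ
  have h2 := norm_le_of_mem_dominatedCone hu hδ hδ1 hy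
  have h3 : inner ℝ w y = inner ℝ u y * inner ℝ w u + inner ℝ w (y - inner ℝ u y • u) := by
    rw [inner_sub_right, inner_smul_right]; ring
  have h4 : -(δ * inner ℝ u y) ≤ inner ℝ w (y - inner ℝ u y • u) := by
    have := abs_real_inner_le_norm w (y - inner ℝ u y • u)
    rw [hw, one_mul] at this
    exact neg_le_of_abs_le (this.trans h)
  rw [h3]
  nlinarith [mul_le_mul_of_nonneg_left hwu h0]

variable [FiniteDimensional ℝ E]

namespace UniformlyDominated

lemma norm_le_mul_norm_apply (h : UniformlyDominated S C r M) {A : E →L[ℝ] E} (hA : A ∈ S)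
    (x : E) : ‖x‖ ≤ M * ‖A x‖ := by
  obtain ⟨A', h1, -, h3⟩ := h.exists_inv A hA
  calc ‖x‖ = ‖A' (A x)‖ := by rw [← mul_apply_eq_comp, h1]; simp
    _ ≤ ‖A'‖ * ‖A x‖ := A'.le_opNorm _
    _ ≤ _ := by gcongr

/-- The condition at `u` for the word `w` followed on the right by `A` is the condition at `A u` for
`w`, with one more factor `r`. The denominator is the price of passing from `⟪u, y⟫ * ‖A u‖ ^ 2` to
`⟪A u, A y⟫`. -/
lemma apply_mem_dominatedCone (h : UniformlyDominated S C r M) (hu : ‖u‖ = 1) (hδ : 0 < δ)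
    (hδM : M ^ 2 * δ < 1) {A : E →L[ℝ] E} (hA : A ∈ S) (hy : y ∈ dominatedCone S r δ u) :
    A y ∈ dominatedCone S r (r * δ / (1 - M ^ 2 * δ)) (A u) := by
  have hM := h.one_le_M
  have hr := h.r_pos
  have hz := norm_sub_inner_smul_le_of_mem_dominatedCone hu hy
  have hτ : 0 ≤ inner ℝ u y := nonneg_of_mul_nonneg_right ((norm_nonneg _).trans hz) hδ
  have hAu : 1 ≤ M * ‖A u‖ := by simpa [hu] using h.norm_le_mul_norm_apply hA u
  have h1 : (1 - M ^ 2 * δ) * (inner ℝ u y * ‖A u‖ ^ 2) ≤ inner ℝ (A u) (A y) := by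
    have e : inner ℝ (A u) (A y) =
        inner ℝ u y * ‖A u‖ ^ 2 + inner ℝ (A u) (A (y - inner ℝ u y • u)) := by
      rw [map_sub, map_smul, inner_sub_right, inner_smul_right, real_inner_self_eq_norm_sq]
      ring
    have e1 : ‖A (y - inner ℝ u y • u)‖ ≤ M * (δ * inner ℝ u y) :=
      (A.le_opNorm _).trans (mul_le_mul (h.norm_le A hA) hz (norm_nonneg _) (by positivity))
    have e2 := abs_real_inner_le_norm (A u) (A (y - inner ℝ u y • u))
    have e3 : ‖A u‖ * ‖A (y - inner ℝ u y • u)‖ ≤ M ^ 2 * δ * (inner ℝ u y * ‖A u‖ ^ 2) := by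
      calc _ ≤ ‖A u‖ * (M * (δ * inner ℝ u y)) := by gcongr
        _ = ‖A u‖ * (M * (δ * inner ℝ u y)) * 1 := by ring
        _ ≤ ‖A u‖ * (M * (δ * inner ℝ u y)) * (M * ‖A u‖) := by gcongr
        _ = _ := by ring
    rw [e]
    linarith [neg_le_of_abs_le (e2.trans e3)]
  intro w hw
  have h2 := hy (w ++ [A]) (by
    intro D hD
    rcases List.mem_append.1 hD with hD | hD
    · exact hw D hD
    · rw [List.mem_singleton.1 hD]; exact hA)
  simp only [List.prod_append, List.prod_singleton, List.length_append, List.length_singleton,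
    mul_apply_eq_comp, hu, one_pow, mul_one] at h2
  have hpos : 0 < 1 - M ^ 2 * δ := by linarith
  set k := 1 - M ^ 2 * δ
  clear_value k
  calc _ ≤ (δ * r ^ (w.length + 1) * ‖w.prod (A u)‖ ^ 2 * inner ℝ u y) * ‖A u‖ ^ 2 := by gcongr
    _ = r * δ / k * r ^ w.length * ‖w.prod (A u)‖ ^ 2 *
        (k * (inner ℝ u y * ‖A u‖ ^ 2)) := by field_simp; ring
    _ ≤ _ := by gcongr

/-- Moving the axis and perturbing `y` adds wedge terms bounded by `6 * ‖Q‖ * σ₂(Q)`. Domination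
gives them the same decay `r ^ n` as in the cone condition, and expansion of `u'` replaces `‖Q‖` by
`‖Q u'‖ / ε`; hence one `η` works for all words at once. -/
lemma ball_subset_dominatedCone [Nontrivial E] (h : UniformlyDominated S C r M) (hu : ‖u‖ = 1)
    (hu' : ‖u'‖ = 1) (hε : 0 < ε) (hue : IsExpanded S ε u') (hδ : 0 < δ) (hδ1 : δ ≤ 1)
    (hδ' : 0 < δ') (hη : 0 ≤ η)
    (hconst : δ * (1 + η / ε) ^ 2 + 18 * C * η / ε ^ 2 ≤ δ' * (1 - 3 * η))
    (huu : ‖u - u'‖ ≤ η) (hy : y ∈ dominatedCone S r δ u) {s : E} (hs : ‖s‖ ≤ η * inner ℝ u y) :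
    y + s ∈ dominatedCone S r δ' u' := by
  have hC := h.one_le_C
  have hr := h.r_pos
  have hτ : 0 ≤ inner ℝ u y := nonneg_of_mul_nonneg_right
    ((norm_nonneg _).trans (norm_sub_inner_smul_le_of_mem_dominatedCone hu hy)) hδ
  have hyn := norm_le_of_mem_dominatedCone hu hδ hδ1 hy
  set τ := inner ℝ u y with hτ_def
  have hinner : τ * (1 - 3 * η) ≤ inner ℝ u' (y + s) := by
    have e : inner ℝ u' (y + s) = τ - inner ℝ (u - u') y + inner ℝ u' s := by
      rw [inner_add_right, inner_sub_left, hτ_def]; ring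
    have e1 : inner ℝ (u - u') y ≤ η * (2 * τ) :=
      (real_inner_le_norm _ _).trans (by gcongr)
    have e2 : -(η * τ) ≤ inner ℝ u' s := by
      have := abs_real_inner_le_norm u' s
      rw [hu', one_mul] at this
      exact neg_le_of_abs_le (this.trans hs)
    rw [e]; linarith
  intro w hw
  set Q := w.prod
  have hQ : ‖Q‖ ≤ ‖Q u'‖ / ε := by
    rw [le_div_iff₀ hε]
    have := hue w hw
    rw [hu'] at this
    linarith
  have hQu : ‖Q u‖ ≤ ‖Q u'‖ * (1 + η / ε) := by
    have e : Q u = Q u' + Q (u - u') := by rw [map_sub]; abel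
    calc ‖Q u‖ ≤ ‖Q u'‖ + ‖Q (u - u')‖ := by rw [e]; exact norm_add_le _ _
      _ ≤ ‖Q u'‖ + ‖Q u'‖ / ε * η := by
        gcongr
        exact (Q.le_opNorm _).trans (by gcongr)
      _ = _ := by ring
  have hwedge : ∀ a b : E, ‖wedge (Q a) (Q b)‖ ≤
      6 * C * r ^ w.length * (‖Q u'‖ / ε) ^ 2 * (‖a‖ * ‖b‖) := by
    intro a b
    calc _ ≤ 6 * ‖Q‖ * secondSingularValue Q * ‖a‖ * ‖b‖ := norm_wedge_map_le Q a b
      _ ≤ 6 * ‖Q‖ * (C * r ^ w.length * ‖Q‖) * ‖a‖ * ‖b‖ := by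
        gcongr; exact h.dominated w hw
      _ = 6 * C * r ^ w.length * ‖Q‖ ^ 2 * (‖a‖ * ‖b‖) := by ring
      _ ≤ _ := by gcongr
  have e : wedge (Q u') (Q (y + s)) =
      wedge (Q u) (Q y) + wedge (Q (u' - u)) (Q y) + wedge (Q u') (Q s) := by
    rw [← wedge_add_left, ← map_add, add_sub_cancel, map_add, wedge_add_right]
  have h1 : ‖wedge (Q u) (Q y)‖ ≤ δ * r ^ w.length * (‖Q u'‖ * (1 + η / ε)) ^ 2 * τ := by
    have := hy w hw
    rw [hu, one_pow, mul_one] at this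
    exact this.trans (by gcongr)
  have h2 : ‖wedge (Q (u' - u)) (Q y)‖ ≤
      6 * C * r ^ w.length * (‖Q u'‖ / ε) ^ 2 * (η * (2 * τ)) := by
    refine (hwedge _ _).trans ?_
    rw [norm_sub_rev]
    gcongr
  have h3 : ‖wedge (Q u') (Q s)‖ ≤ 6 * C * r ^ w.length * (‖Q u'‖ / ε) ^ 2 * (η * τ) := by
    refine (hwedge _ _).trans ?_
    rw [hu', one_mul]
    gcongr
  rw [e, hu', one_pow, mul_one]
  calc _ ≤ _ := norm_add₃_le
    _ ≤ _ := add_le_add (add_le_add h1 h2) h3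
    _ = r ^ w.length * ‖Q u'‖ ^ 2 * τ * (δ * (1 + η / ε) ^ 2 + 18 * C * η / ε ^ 2) := by ring
    _ ≤ r ^ w.length * ‖Q u'‖ ^ 2 * τ * (δ' * (1 - 3 * η)) := by gcongr
    _ = δ' * r ^ w.length * ‖Q u'‖ ^ 2 * (τ * (1 - 3 * η)) := by ring
    _ ≤ _ := by gcongr

lemma mem_interior_dominatedCone [Nontrivial E] (h : UniformlyDominated S C r M) (hu : ‖u‖ = 1)
    (hu' : ‖u'‖ = 1) (hε : 0 < ε) (hue : IsExpanded S ε u') (hδ : 0 < δ) (hδ1 : δ ≤ 1)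
    (hδ' : 0 < δ') (hη : 0 < η)
    (hconst : δ * (1 + η / ε) ^ 2 + 18 * C * η / ε ^ 2 ≤ δ' * (1 - 3 * η))
    (huu : ‖u - u'‖ ≤ η) (hy : y ∈ dominatedCone S r δ u) (hy0 : y ≠ 0) :
    y ∈ interior (dominatedCone S r δ' u') := by
  have hτ := inner_pos_of_mem_dominatedCone hu hδ hy hy0
  rw [mem_interior_iff_mem_nhds, Metric.mem_nhds_iff]
  refine ⟨η * inner ℝ u y, by positivity, fun z hz => ?_⟩
  have := h.ball_subset_dominatedCone hu hu' hε hue hδ hδ1 hδ' hη.le hconst huu hy (s := z - y)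
    (by rw [← dist_eq_norm]; exact (Metric.mem_ball.1 hz).le)
  simpa using this

lemma exists_small (h : UniformlyDominated S C r M) {c : ℝ} (hc : 0 < c) :
    ∃ N : ℕ, C * r ^ N ≤ c := by
  have hC := h.one_le_C
  obtain ⟨N, hN⟩ := exists_pow_lt_of_lt_one (show 0 < c / C by positivity) h.r_lt_one
  refine ⟨N, ?_⟩
  rw [lt_div_iff₀ (by positivity)] at hN
  linarith

/-- There is a vector whose whole orbit is uniformly expanded. -/
lemma exists_expanded_orbit [Nontrivial E] (h : UniformlyDominated S C r M) (hne : S.Nonempty) :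
    ∃ x : E, x ≠ 0 ∧ ∃ ε : ℝ, 0 < ε ∧ ∀ z : List (E →L[ℝ] E), (∀ A ∈ z, A ∈ S) →
      IsExpanded S ε (z.prod x) := by
  obtain ⟨c, hc, hqm⟩ := h.exists_quasiMultiplicative
  obtain ⟨N, hN⟩ := h.exists_small (show 0 < c / 2 by positivity)
  obtain ⟨A, hA⟩ := hne
  have hP : ∀ B ∈ List.replicate N A, B ∈ S := fun B hB => by
    rw [List.eq_of_mem_replicate hB]; exact hA
  set p := List.replicate N A
  -- For this long word, the part of `‖w.prod * p.prod‖` not seen on `v` is at most half of the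
  -- quasi-multiplicative lower bound.
  obtain ⟨v, hv, hPv, hperp⟩ := exists_top_singular_vector p.prod
  have hbase : ∀ w : List (E →L[ℝ] E), (∀ A ∈ w, A ∈ S) →
      c / 2 * (‖w.prod‖ * ‖p.prod v‖) ≤ ‖w.prod (p.prod v)‖ := by
    intro w hw
    have h1 := (hqm w p hw hP).trans (norm_mul_le_norm_apply_add w.prod p.prod hv hperp)
    have h2 : secondSingularValue p.prod ≤ c / 2 * ‖p.prod‖ :=
      (h.dominated p hP).trans (by gcongr; simpa [p] using hN)
    have h3 : ‖w.prod‖ * secondSingularValue p.prod ≤ ‖w.prod‖ * (c / 2 * ‖p.prod‖) := by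
      gcongr
    rw [hPv]
    linarith
  -- One factor `c / 2` comes from `hbase` for the word `w ++ z`, the other `c` from splitting its
  -- norm.
  refine ⟨p.prod v, ?_, c ^ 2 / 2, by positivity, fun z hz w hw => ?_⟩
  · rw [← norm_pos_iff, hPv]
    exact h.norm_prod_pos p hP
  · have h1 := hbase (w ++ z) (by
      intro D hD
      rcases List.mem_append.1 hD with hD | hD
      · exact hw D hD
      · exact hz D hD)
    rw [List.prod_append, mul_apply_eq_comp] at h1
    refine le_trans ?_ h1
    have h2 := hqm w z hw hz
    have h3 := z.prod.le_opNorm (p.prod v)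
    calc _ ≤ c ^ 2 / 2 * (‖w.prod‖ * (‖z.prod‖ * ‖p.prod v‖)) := by gcongr
      _ = c / 2 * ((c * (‖w.prod‖ * ‖z.prod‖)) * ‖p.prod v‖) := by ring
      _ ≤ _ := by gcongr

/-- All expanded vectors are uniformly transverse to a common hyperplane. -/
lemma exists_transverse [Nontrivial E] (h : UniformlyDominated S C r M) (hne : S.Nonempty)
    (hε : 0 < ε) : ∃ w : E, ‖w‖ = 1 ∧ ∀ u, IsExpanded S ε u →
      ε / 2 * ‖u‖ ≤ |inner ℝ w u| := by
  obtain ⟨N, hN⟩ := h.exists_small (show 0 < ε / 2 by positivity)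
  obtain ⟨A, hA⟩ := hne
  have hP : ∀ B ∈ List.replicate N A, B ∈ S := fun B hB => by
    rw [List.eq_of_mem_replicate hB]; exact hA
  set p := List.replicate N A
  obtain ⟨v, hv, hPv, hperp⟩ := exists_top_singular_vector p.prod
  -- On the complement of `v` the product `p` has norm at most `ε / 2 * ‖p.prod‖`, so an expanded
  -- vector needs a definite component along `v`.
  refine ⟨v, hv, fun u hu => ?_⟩
  obtain ⟨a, b, hab, hvb, -, hb⟩ := exists_decomposition_of_norm_eq_one hv u
  have ha : inner ℝ v u = a := by
    rw [hab, inner_add_right, inner_smul_right, hvb, real_inner_self_eq_norm_sq, hv]; ring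
  rw [ha]
  have h1 := hu p hP
  have h2 : ‖p.prod u‖ ≤ |a| * ‖p.prod‖ + ε / 2 * ‖p.prod‖ * ‖u‖ := by
    conv_lhs => rw [hab, map_add, map_smul]
    refine (norm_add_le _ _).trans ?_
    rw [norm_smul, hPv, Real.norm_eq_abs]
    gcongr
    refine (hperp b hvb).trans ?_
    gcongr
    exact (h.dominated p hP).trans (by gcongr; simpa [p] using hN)
  have hpos := h.norm_prod_pos p hP
  refine le_of_mul_le_mul_right ?_ hpos
  linarith

/-- `M ^ 2 * δ ≤ (1 - r) / 2` makes the aperture after one step strictly smaller than `δ`. The last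
inequality is then strict at `η = 0`, and continuity yields a positive `η`. -/
lemma exists_constants (h : UniformlyDominated S C r M) (hε : 0 < ε) :
    ∃ δ η : ℝ, 0 < δ ∧ δ ≤ 1 ∧ 4 * δ ≤ ε ∧ M ^ 2 * δ < 1 ∧
      r * δ / (1 - M ^ 2 * δ) ≤ 1 ∧ 0 < r * δ / (1 - M ^ 2 * δ) ∧ 0 < η ∧
      r * δ / (1 - M ^ 2 * δ) * (1 + η / ε) ^ 2 + 18 * C * η / ε ^ 2 ≤ δ * (1 - 3 * η) := by
  have hM := h.one_le_M
  have hr := h.r_pos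
  have hr1 := h.r_lt_one
  set δ := min (min 1 (ε / 4)) ((1 - r) / (2 * M ^ 2)) with hδ_def
  have hδ : 0 < δ := by
    have : 0 < (1 - r) / (2 * M ^ 2) := div_pos (by linarith) (by positivity)
    exact lt_min (lt_min one_pos (by positivity)) this
  have h1 : δ ≤ 1 := (min_le_left _ _).trans (min_le_left _ _)
  have h2 : δ ≤ ε / 4 := (min_le_left _ _).trans (min_le_right _ _)
  have h3 : M ^ 2 * δ ≤ (1 - r) / 2 := by
    have : δ ≤ (1 - r) / (2 * M ^ 2) := min_le_right _ _
    rw [le_div_iff₀ (by positivity)] at this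
    linarith
  have hpos : 0 < 1 - M ^ 2 * δ := by linarith
  have hlt : r * δ / (1 - M ^ 2 * δ) < δ := by
    rw [div_lt_iff₀ hpos]
    nlinarith
  have hcont : Continuous fun η : ℝ =>
      δ * (1 - 3 * η) - (r * δ / (1 - M ^ 2 * δ) * (1 + η / ε) ^ 2 + 18 * C * η / ε ^ 2) := by
    fun_prop
  have hev := hcont.continuousAt.eventually (lt_mem_nhds (a := (0 : ℝ)) (b := _) (by
    show 0 < δ * (1 - 3 * (0 : ℝ)) -
      (r * δ / (1 - M ^ 2 * δ) * (1 + 0 / ε) ^ 2 + 18 * C * 0 / ε ^ 2)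
    simpa using hlt))
  obtain ⟨ρ, hρ, hball⟩ := Metric.eventually_nhds_iff.1 hev
  refine ⟨δ, ρ / 2, hδ, h1, by linarith, by linarith, hlt.le.trans h1, by positivity,
    by positivity, ?_⟩
  have := hball (y := ρ / 2) (by
    rw [Real.dist_eq, sub_zero, abs_of_pos (by positivity)]; linarith)
  linarith

/-- Dominated sets admit finite families of invariant cones. -/
theorem exists_isPreMulticone [Nontrivial E] (h : UniformlyDominated S C r M)
    (hne : S.Nonempty) : ∃ (F : Set E) (_ : F.Finite) (_ : F.Nonempty) (K : F → Set E) (w : E)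
      (κ : ℝ), ‖w‖ = 1 ∧ IsPreMulticone S K w κ := by
  obtain ⟨x, hx, ε, hε, hexp⟩ := h.exists_expanded_orbit hne
  obtain ⟨w, hw, htrans⟩ := h.exists_transverse hne hε
  obtain ⟨δ, η, hδ, hδ1, hδε, hδM, hδ'1, hδ'0, hη, hconst⟩ :=
    h.exists_constants (show 0 < ε / 2 by positivity)
  have hr := h.r_pos
  have hM := h.one_le_M
  -- normalized orbit on the positive side of the hyperplane orthogonal to `w`
  set O : Set E := {u | ‖u‖ = 1 ∧ 0 < inner ℝ w u ∧ ∃ a : ℝ, a ≠ 0 ∧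
    ∃ z : List (E →L[ℝ] E), (∀ A ∈ z, A ∈ S) ∧ u = a • z.prod x} with hO
  have hOexp : ∀ u ∈ O, IsExpanded S (ε / 2) u := by
    rintro u ⟨-, -, a, -, z, hz, rfl⟩ v hv
    refine le_trans ?_ ((hexp z hz).smul a v hv)
    gcongr
    linarith
  have hOtrans : ∀ u ∈ O, ε / 2 ≤ inner ℝ w u := by
    rintro u ⟨hu1, hu2, a, ha, z, hz, rfl⟩
    have := htrans _ ((hexp z hz).smul a)
    rwa [hu1, mul_one, abs_of_pos hu2] at this
  have hOmem : ∀ z : List (E →L[ℝ] E), (∀ A ∈ z, A ∈ S) → ∀ a : ℝ, a ≠ 0 →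
      ∃ b : ℝ, b ≠ 0 ∧ b • (a • z.prod x) ∈ O := by
    intro z hz a ha
    have hzx : z.prod x ≠ 0 := by
      intro h0
      obtain ⟨U, hU⟩ := h.isUnit_prod z hz
      have : (U⁻¹.val * U.val) x = 0 := by rw [mul_apply_eq_comp, hU, h0, map_zero]
      rw [Units.inv_mul] at this
      exact hx (by simpa using this)
    set v := a • z.prod x with hv
    have hv0 : v ≠ 0 := smul_ne_zero ha hzx
    have hvpos : 0 < ‖v‖ := norm_pos_iff.2 hv0
    have hwv : inner ℝ w v ≠ 0 := by
      intro h0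
      have := htrans _ ((hexp z hz).smul a)
      rw [← hv, h0, abs_zero] at this
      exact absurd this (not_le.2 (by positivity))
    rcases lt_or_gt_of_ne hwv with hneg | hpos
    · refine ⟨-‖v‖⁻¹, by simpa using hv0, ?_, ?_, -‖v‖⁻¹ * a, ?_, z, hz, by rw [hv, smul_smul]⟩
      · rw [norm_smul, norm_neg, norm_inv, norm_norm, inv_mul_cancel₀ hvpos.ne']
      · rw [inner_smul_right]
        exact mul_pos_of_neg_of_neg (by simpa using hv0) hneg
      · exact mul_ne_zero (by simpa using hv0) ha
    · refine ⟨‖v‖⁻¹, by simpa using hv0, ?_, ?_, ‖v‖⁻¹ * a, ?_, z, hz, by rw [hv, smul_smul]⟩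
      · rw [norm_smul, norm_inv, norm_norm, inv_mul_cancel₀ hvpos.ne']
      · rw [inner_smul_right]
        positivity
      · exact mul_ne_zero (by simpa using hv0) ha
  -- A finite `η`-net of the orbit, chosen inside the orbit so that its points are themselves
  -- expanded and transverse.
  have hbdd : TotallyBounded O :=
    ((isCompact_closedBall (0 : E) 1).totallyBounded).subset fun u hu => by simp [hu.1]
  obtain ⟨F, hFO, hFfin, hFcover⟩ := Metric.finite_approx_of_totallyBounded hbdd η hη
  have hcover : ∀ u ∈ O, ∃ f ∈ F, ‖u - f‖ ≤ η := fun u hu => by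
    obtain ⟨f, hf, hfu⟩ := Set.mem_iUnion₂.1 (hFcover hu)
    exact ⟨f, hf, by rw [← dist_eq_norm]; exact (Metric.mem_ball.1 hfu).le⟩
  have hFne : F.Nonempty := by
    obtain ⟨b, -, hb⟩ := hOmem [] (by simp) 1 one_ne_zero
    obtain ⟨f, hf, -⟩ := hcover _ hb
    exact ⟨f, hf⟩
  refine ⟨F, hFfin, hFne, fun f => dominatedCone S r δ (f : E), w, ε / 2 / 4, hw, ?_⟩
  have hmain : ∀ u ∈ O, ∃ f ∈ F, ∀ y ∈ dominatedCone S r (r * δ / (1 - M ^ 2 * δ)) u,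
      y ≠ 0 → y ∈ interior (dominatedCone S r δ f) := by
    intro u hu
    obtain ⟨f, hf, huf⟩ := hcover u hu
    exact ⟨f, hf, fun y hy hy0 => h.mem_interior_dominatedCone hu.1 (hFO hf).1
      (show 0 < ε / 2 by positivity) (hOexp f (hFO hf)) hδ'0 hδ'1 hδ hη hconst huf hy hy0⟩
  constructor
  · exact fun _ => isClosed_dominatedCone
  · exact fun _ x hx y hy => add_mem_dominatedCone hx hy
  · exact fun _ a ha x hx => smul_mem_dominatedCone ha hx
  · rintro ⟨f, hf⟩
    have hf1 := (hFO hf).1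
    refine ⟨f, h.mem_interior_dominatedCone hf1 hf1 (show 0 < ε / 2 by positivity)
      (hOexp f (hFO hf)) hδ'0 hδ'1 hδ hη hconst (by simpa using hη.le)
      (self_mem_dominatedCone hr.le hδ'0.le) ?_⟩
    rw [← norm_pos_iff, hf1]; exact one_pos
  · positivity
  · rintro ⟨f, hf⟩ y hy
    exact transverse_of_mem_dominatedCone hw (hFO hf).1 hδ hδ1 (by linarith)
      (hOtrans f (hFO hf)) hy
  · rintro A hA ⟨f, hf⟩
    obtain ⟨hf1, -, a, ha, z, hz, hfz⟩ := hFO hf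
    obtain ⟨b, hb, hbO⟩ := hOmem (A :: z) (by
      intro D hD
      rcases List.mem_cons.1 hD with rfl | hD
      · exact hA
      · exact hz D hD) a ha
    have hAf : a • (A :: z).prod x = A f := by
      rw [hfz, List.prod_cons, mul_apply_eq_comp, map_smul]
    rw [hAf] at hbO
    obtain ⟨g, hg, hgO⟩ := hmain _ hbO
    have hne0 : ∀ y, y ≠ 0 → A y ≠ 0 := by
      intro y hy h0
      have := h.norm_le_mul_norm_apply hA y
      rw [h0, norm_zero, mul_zero] at this
      exact hy (norm_le_zero_iff.1 this)
    -- The sign of the scalar that brings `A f` back to the positive side of `w` is the sign with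
    -- which `A` maps the whole cone.
    rcases lt_or_gt_of_ne hb with hneg | hpos
    · refine ⟨⟨g, hg⟩, -1, Or.inr rfl, fun y hy hy0 => ?_⟩
      have h1 := neg_mem_dominatedCone_neg (h.apply_mem_dominatedCone hf1 hδ hδM hA hy)
      rw [← dominatedCone_smul (show 0 < -b by linarith), smul_neg, neg_smul, neg_neg] at h1
      rw [neg_one_smul]
      exact hgO _ h1 (neg_ne_zero.2 (hne0 y hy0))
    · refine ⟨⟨g, hg⟩, 1, Or.inl rfl, fun y hy hy0 => ?_⟩
      have h1 := h.apply_mem_dominatedCone hf1 hδ hδM hA hy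
      rw [← dominatedCone_smul hpos] at h1
      rw [one_smul]
      exact hgO _ h1 (hne0 y hy0)

end UniformlyDominated

end DominatedCones

/-! ### Merging overlapping cones. -/

section MergingCones

variable {E : Type*} [NormedAddCommGroup E] [InnerProductSpace ℝ E]

-- Translating the open set `interior D` by `y` gives an open subset of `D`.
omit [InnerProductSpace ℝ E] in
lemma add_mem_interior_of_add_closed {D : Set E} (hD : ∀ x ∈ D, ∀ y ∈ D, x + y ∈ D) {x y : E}
    (hx : x ∈ interior D) (hy : y ∈ D) : x + y ∈ interior D := by
  have h : interior D + {y} ⊆ interior D := by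
    refine interior_maximal ?_ (isOpen_interior.add_right)
    rintro _ ⟨a, ha, b, hb, rfl⟩
    rw [Set.mem_singleton_iff.1 hb]
    exact hD a (interior_subset ha) y hy
  exact h ⟨x, hx, y, rfl, rfl⟩

lemma zero_notMem_interior_of_transverse {D : Set E} {w : E} (hw : w ≠ 0)
    (hD : ∀ x ∈ D, 0 ≤ inner ℝ w x) : (0 : E) ∉ interior D := by
  intro h0
  have hcont : Filter.Tendsto (fun t : ℝ => -(t • w)) (nhds 0) (nhds 0) := by
    have : Continuous fun t : ℝ => -(t • w) := by fun_prop
    simpa using this.tendsto 0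
  have hev := hcont.eventually (mem_interior_iff_mem_nhds.1 h0)
  obtain ⟨ρ, hρ, hball⟩ := Metric.eventually_nhds_iff.1 hev
  have h1 := hD _ (hball (y := ρ / 2) (by
    rw [Real.dist_eq, sub_zero, abs_of_pos (by positivity)]; linarith))
  rw [inner_neg_right, inner_smul_right] at h1
  have := real_inner_self_pos.2 hw
  nlinarith

variable {ι : Type*} [Fintype ι]

/-- Sums of elements of the cones `K i` with `i ∈ c`. -/
def sumCone (K : ι → Set E) (c : Set ι) : Set E :=
  {y | ∃ f : ι → E, (∀ i, f i ∈ K i) ∧ (∀ i, i ∉ c → f i = 0) ∧ ∑ i, f i = y}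

omit [InnerProductSpace ℝ E] in
lemma sumCone_mono (K : ι → Set E) {c c' : Set ι} (h : c ⊆ c') : sumCone K c ⊆ sumCone K c' :=
  fun _ ⟨f, h1, h2, h3⟩ => ⟨f, h1, fun i hi => h2 i fun hc => hi (h hc), h3⟩

namespace IsPreMulticone

variable {S : Set (E →L[ℝ] E)} {K : ι → Set E} {w : E} {κ : ℝ} {c : Set ι}

omit [Fintype ι] in
lemma zero_mem (h : IsPreMulticone S K w κ) (j : ι) : (0 : E) ∈ K j := by
  obtain ⟨x, hx⟩ := h.interior_nonempty j
  simpa using h.smul_mem j 0 le_rfl x (interior_subset hx)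

lemma subset_sumCone (h : IsPreMulticone S K w κ) {i : ι} (hi : i ∈ c) : K i ⊆ sumCone K c := by
  classical
  intro x hx
  refine ⟨Pi.single i x, fun j => ?_, fun j hj => ?_, by simp⟩
  · by_cases hij : j = i
    · subst hij; simpa using hx
    · simpa [hij] using h.zero_mem j
  · have : j ≠ i := fun hij => hj (hij ▸ hi)
    simp [this]

lemma sumCone_add_mem (h : IsPreMulticone S K w κ) : ∀ x ∈ sumCone K c, ∀ y ∈ sumCone K c,
    x + y ∈ sumCone K c := by
  rintro _ ⟨f, hf1, hf2, rfl⟩ _ ⟨g, hg1, hg2, rfl⟩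
  exact ⟨f + g, fun i => h.add_mem i _ (hf1 i) _ (hg1 i),
    fun i hi => by simp [hf2 i hi, hg2 i hi], by simp [Finset.sum_add_distrib]⟩

lemma sumCone_smul_mem (h : IsPreMulticone S K w κ) (a : ℝ) (ha : 0 ≤ a) :
    ∀ x ∈ sumCone K c, a • x ∈ sumCone K c := by
  rintro _ ⟨f, hf1, hf2, rfl⟩
  exact ⟨a • f, fun i => h.smul_mem i a ha _ (hf1 i), fun i hi => by simp [hf2 i hi],
    by simp [Finset.smul_sum]⟩

lemma zero_mem_sumCone (h : IsPreMulticone S K w κ) : (0 : E) ∈ sumCone K c :=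
  ⟨0, fun i => h.zero_mem i, fun _ _ => rfl, by simp⟩

lemma sum_mem_sumCone (h : IsPreMulticone S K w κ) {α : Type*} (s : Finset α) (f : α → E)
    (hf : ∀ i ∈ s, f i ∈ sumCone K c) : ∑ i ∈ s, f i ∈ sumCone K c :=
  Finset.sum_induction f (· ∈ sumCone K c) (fun x y hx hy => h.sumCone_add_mem x hx y hy)
    h.zero_mem_sumCone hf

lemma transverse_sumCone (h : IsPreMulticone S K w κ) :
    ∀ x ∈ sumCone K c, κ * ‖x‖ ≤ inner ℝ w x := by
  rintro _ ⟨f, hf1, -, rfl⟩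
  have hκ := h.kappa_pos
  calc κ * ‖∑ i, f i‖ ≤ κ * ∑ i, ‖f i‖ := by gcongr; exact norm_sum_le _ _
    _ ≤ ∑ i, inner ℝ w (f i) := by
      rw [Finset.mul_sum]
      exact Finset.sum_le_sum fun i _ => h.transverse i _ (hf1 i)
    _ = _ := (inner_sum _ _ _).symm

lemma zero_notMem_interior_sumCone (h : IsPreMulticone S K w κ) (hw : w ≠ 0) :
    (0 : E) ∉ interior (sumCone K c) :=
  zero_notMem_interior_of_transverse hw fun x hx =>
    (mul_nonneg h.kappa_pos.le (norm_nonneg x)).trans (h.transverse_sumCone x hx)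

/-- Nothing cancels in a sum of vectors on the positive side of `w`: a bounded sum has bounded
summands, and these have a convergent subsequence. -/
lemma isClosed_sumCone [FiniteDimensional ℝ E] (h : IsPreMulticone S K w κ) :
    IsClosed (sumCone K c) := by
  have hκ := h.kappa_pos
  refine IsSeqClosed.isClosed fun y z hy hyz => ?_
  choose f hf1 hf2 hf3 using hy
  obtain ⟨R, hR⟩ := hyz.norm.bddAbove_range
  have hbound : ∀ n, f n ∈ Metric.closedBall (0 : ι → E) (‖w‖ * R / κ) := by
    intro n
    have hyn : ‖y n‖ ≤ R := hR ⟨n, rfl⟩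
    have hR0 : 0 ≤ R := (norm_nonneg _).trans hyn
    rw [mem_closedBall_zero_iff, pi_norm_le_iff_of_nonneg (by positivity)]
    intro i
    rw [le_div_iff₀ hκ, mul_comm]
    have hnn : ∀ j, 0 ≤ inner ℝ w (f n j) := fun j =>
      (mul_nonneg hκ.le (norm_nonneg _)).trans (h.transverse j _ (hf1 n j))
    calc κ * ‖f n i‖ ≤ inner ℝ w (f n i) := h.transverse i _ (hf1 n i)
      _ ≤ ∑ j, inner ℝ w (f n j) :=
        Finset.single_le_sum (f := fun j => (inner ℝ w (f n j) : ℝ)) (fun j _ => hnn j)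
          (Finset.mem_univ i)
      _ = inner ℝ w (y n) := by rw [← inner_sum, hf3]
      _ ≤ ‖w‖ * ‖y n‖ := real_inner_le_norm _ _
      _ ≤ ‖w‖ * R := by gcongr
  obtain ⟨g, -, φ, hφ, hg⟩ := (isCompact_closedBall (0 : ι → E) (‖w‖ * R / κ)).tendsto_subseq hbound
  have hgi : ∀ i, Filter.Tendsto (fun n => f (φ n) i) Filter.atTop (nhds (g i)) :=
    fun i => tendsto_pi_nhds.1 hg i
  refine ⟨g, fun i => ?_, fun i hi => ?_, ?_⟩
  · exact (h.isClosed i).mem_of_tendsto (hgi i) (Filter.Eventually.of_forall fun n => hf1 _ i)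
  · refine tendsto_nhds_unique (hgi i) ?_
    simp only [hf2 _ i hi]
    exact tendsto_const_nhds
  · refine tendsto_nhds_unique (tendsto_finsetSum _ fun i _ => hgi i) ?_
    simp only [hf3]
    exact hyz.comp hφ.tendsto_atTop

/-- Some summand is nonzero and lands in the interior; adding the images of the others does not
leave it. -/
lemma map_sumCone (h : IsPreMulticone S K w κ) {A : E →L[ℝ] E} {l : ι → ι} {s : ι → ℝ}
    (hA : ∀ j, ∀ x ∈ K j, x ≠ 0 → s j • A x ∈ interior (K (l j))) {σ : ℝ} {x : E}
    (hx : x ∈ sumCone K {k | l k ∈ c ∧ s k = σ}) (hx0 : x ≠ 0) :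
    σ • A x ∈ interior (sumCone K c) := by
  classical
  obtain ⟨f, hf1, hf2, rfl⟩ := hx
  obtain ⟨i, -, hi⟩ := Finset.exists_ne_zero_of_sum_ne_zero hx0
  have hterm : ∀ k, f k ≠ 0 → σ • A (f k) ∈ interior (sumCone K c) := by
    intro k hk
    have hkc : l k ∈ c ∧ s k = σ := by
      by_contra hc
      exact hk (hf2 k hc)
    rw [← hkc.2]
    exact interior_mono (h.subset_sumCone hkc.1) (hA k _ (hf1 k) hk)
  rw [map_sum, Finset.smul_sum, ← Finset.add_sum_erase _ _ (Finset.mem_univ i)]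
  refine add_mem_interior_of_add_closed h.sumCone_add_mem (hterm i hi)
    (h.sum_mem_sumCone _ _ fun k _ => ?_)
  by_cases hk : f k = 0
  · rw [hk, map_zero, smul_zero]; exact h.zero_mem_sumCone
  · exact interior_subset (hterm k hk)

end IsPreMulticone

/-- The cones generated by distinct classes of the equivalence relation meet only at the origin. -/
def IsSeparating (K : ι → Set E) (r : Setoid ι) : Prop :=
  ∀ i j, ¬ r i j → ∀ x ∈ sumCone K {k | r i k}, x ∈ sumCone K {k | r j k} → x = 0

-- A finer relation has smaller class cones, and two indices unrelated in the infimum are unrelated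
-- in some separating relation. This gives a least separating relation.
omit [InnerProductSpace ℝ E] in
lemma isSeparating_sInf (K : ι → Set E) : IsSeparating K (sInf {r | IsSeparating K r}) := by
  intro i j hij x hxi hxj
  have hij' : ∃ r : Setoid ι, IsSeparating K r ∧ ¬ r i j := by
    by_contra! hcon
    exact hij fun r hr => hcon r hr
  obtain ⟨r, hr, hrij⟩ := hij'
  have hle : sInf {r | IsSeparating K r} ≤ r := sInf_le hr
  exact hr i j hrij x (sumCone_mono K (fun k hk => hle hk) hxi)
    (sumCone_mono K (fun k hk => hle hk) hxj)

/-- A nonzero `x` common to two class cones has signed images in the interiors of two class cones.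
Both images lie on the positive side of `w`, so the signs agree; then the target classes differ and
the image is `0`, which is not interior. -/
lemma IsPreMulticone.isSeparating_comap {S : Set (E →L[ℝ] E)} {K : ι → Set E} {w : E} {κ : ℝ}
    (h : IsPreMulticone S K w κ) (hw : w ≠ 0) {A : E →L[ℝ] E} {l : ι → ι} {s : ι → ℝ}
    (hs : ∀ j, s j = 1 ∨ s j = -1)
    (hA : ∀ j, ∀ x ∈ K j, x ≠ 0 → s j • A x ∈ interior (K (l j))) {r : Setoid ι}
    (hr : IsSeparating K r) : IsSeparating K (Setoid.comap l r ⊓ Setoid.ker s) := by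
  intro i j hij x hxi hxj
  by_contra hx0
  have hmem : ∀ i, x ∈ sumCone K {k | (Setoid.comap l r ⊓ Setoid.ker s) i k} →
      s i • A x ∈ interior (sumCone K {k | r (l i) k}) := by
    intro i hxi
    refine h.map_sumCone hA (sumCone_mono K ?_ hxi) hx0
    rintro k ⟨hk1, hk2⟩
    exact ⟨hk1, (Setoid.ker_def.1 hk2).symm⟩
  have hi := hmem i hxi
  have hj := hmem j hxj
  have hpos : ∀ i, s i • A x ∈ interior (sumCone K {k | r (l i) k}) →
      0 < s i * inner ℝ w (A x) := by
    intro i hi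
    have h1 := h.transverse_sumCone _ (interior_subset hi)
    rw [inner_smul_right] at h1
    refine lt_of_lt_of_le (mul_pos h.kappa_pos (norm_pos_iff.2 fun h0 => ?_)) h1
    rw [h0] at hi
    exact h.zero_notMem_interior_sumCone hw hi
  have hss : s i = s j := by
    have h1 := hpos i hi
    have h2 := hpos j hj
    rcases hs i with e1 | e1 <;> rcases hs j with e2 | e2 <;> rw [e1] at h1 ⊢ <;>
      rw [e2] at h2 ⊢ <;> linarith
  have hrl : ¬ r (l i) (l j) := fun hrl => hij ⟨hrl, Setoid.ker_def.2 hss⟩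
  have h0 := hr _ _ hrl _ (interior_subset hi) (by rw [hss]; exact interior_subset hj)
  rw [h0] at hi
  exact h.zero_notMem_interior_sumCone hw hi

/-- Overlapping cones of a strictly preserved family can be merged into disjoint ones. -/
theorem IsPreMulticone.exists_disjoint [FiniteDimensional ℝ E] {S : Set (E →L[ℝ] E)}
    {K : ι → Set E} {w : E} {κ : ℝ} (h : IsPreMulticone S K w κ) (hw : w ≠ 0) :
    ∃ (r : Setoid ι) (K' : Quotient r → Set E), IsPreMulticone S K' w κ ∧
      ∀ q q', q ≠ q' → K' q ∩ K' q' = {0} := by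
  set r : Setoid ι := sInf {r | IsSeparating K r}
  have hr : IsSeparating K r := isSeparating_sInf K
  have hclass : ∀ i : ι, {k | (Quotient.mk r k) = Quotient.mk r i} = {k | r i k} := by
    intro i; ext k
    exact ⟨fun hk => r.symm' (Quotient.exact hk), fun hk => Quotient.sound (r.symm' hk)⟩
  refine ⟨r, fun q => sumCone K {k | Quotient.mk r k = q}, ?_, ?_⟩
  · constructor
    · exact fun _ => h.isClosed_sumCone
    · exact fun _ => h.sumCone_add_mem
    · exact fun _ a ha x hx => h.sumCone_smul_mem a ha x hx
    · intro q
      obtain ⟨i, rfl⟩ := Quotient.exists_rep q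
      exact (h.interior_nonempty i).mono (interior_mono (h.subset_sumCone rfl))
    · exact h.kappa_pos
    · exact fun _ => h.transverse_sumCone
    · intro A hA q
      obtain ⟨i, rfl⟩ := Quotient.exists_rep q
      choose l s hs hl using h.mapsTo A hA
      -- Minimality of `r`: equivalent cones are sent by `A` into equivalent cones with the same
      -- sign.
      have hle : r ≤ Setoid.comap l r ⊓ Setoid.ker s :=
        sInf_le (h.isSeparating_comap hw hs hl hr)
      refine ⟨Quotient.mk r (l i), s i, hs i, fun x hx hx0 => ?_⟩
      simp only [hclass] at hx ⊢
      refine h.map_sumCone hl (sumCone_mono K ?_ hx) hx0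
      intro k hk
      obtain ⟨h1, h2⟩ := hle hk
      exact ⟨h1, (Setoid.ker_def.1 h2).symm⟩
  · intro q q' hqq
    obtain ⟨i, rfl⟩ := Quotient.exists_rep q
    obtain ⟨j, rfl⟩ := Quotient.exists_rep q'
    refine Set.eq_singleton_iff_unique_mem.2
      ⟨⟨h.zero_mem_sumCone, h.zero_mem_sumCone⟩, fun x hx => ?_⟩
    simp only [hclass] at hx
    exact hr i j (fun hij => hqq (Quotient.sound hij)) x hx.1 hx.2

end MergingCones

/-! ### Contraction by cones, and domination. -/

section ConeContraction

variable {E : Type*} [NormedAddCommGroup E] [InnerProductSpace ℝ E] [FiniteDimensional ℝ E]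

/-- A strictly preserved finite family of acute cones, where images may land in the interior of a
cone or of its opposite, is a premulticone. -/
lemma isPreMulticone_of_convex {ι : Type*} [Finite ι] {S : Set (E →L[ℝ] E)} {K : ι → Set E}
    {w : E} (hw : w ≠ 0) (hclosed : ∀ j, IsClosed (K j)) (hconvex : ∀ j, Convex ℝ (K j))
    (hint : ∀ j, (interior (K j)).Nonempty)
    (hsmul : ∀ j, ∀ a : ℝ, 0 ≤ a → ∀ x ∈ K j, a • x ∈ K j)
    (hpos : ∀ j, ∀ x ∈ K j, x ≠ 0 → 0 < inner ℝ w x)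
    (hmaps : ∀ A ∈ S, ∀ j, ∃ l, A '' (K j \ {0}) ⊆ interior (K l) ∪ -interior (K l)) :
    ∃ κ, IsPreMulticone S K w κ := by
  obtain ⟨κ, hκ, htrans⟩ : ∃ κ : ℝ, 0 < κ ∧ ∀ j, ∀ x ∈ K j, κ * ‖x‖ ≤ inner ℝ w x := by
    -- `κ` is the minimum of `⟪w, ·⟫` over unit vectors of the finitely many closed cones.
    have hcomp : IsCompact ((⋃ j, K j) ∩ Metric.sphere (0 : E) 1) :=
      (isCompact_sphere 0 1).inter_left (isClosed_iUnion_of_finite hclosed)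
    obtain ⟨κ, hκ, hκle⟩ : ∃ κ : ℝ, 0 < κ ∧
        ∀ x ∈ (⋃ j, K j) ∩ Metric.sphere (0 : E) 1, κ ≤ inner ℝ w x := by
      rcases ((⋃ j, K j) ∩ Metric.sphere (0 : E) 1).eq_empty_or_nonempty with he | hne
      · exact ⟨1, one_pos, by simp [he]⟩
      · obtain ⟨x0, hx0, hmin⟩ := hcomp.exists_isMinOn (f := fun x => (inner ℝ w x : ℝ)) hne
          (by fun_prop)
        obtain ⟨j, hj⟩ := Set.mem_iUnion.1 hx0.1
        refine ⟨inner ℝ w x0, hpos j x0 hj ?_, fun x hx => hmin hx⟩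
        rintro rfl
        simpa using hx0.2
    refine ⟨κ, hκ, fun j x hx => ?_⟩
    by_cases hx0 : x = 0
    · simp [hx0]
    · have hn : 0 < ‖x‖ := norm_pos_iff.2 hx0
      have h1 := hκle (‖x‖⁻¹ • x) ⟨Set.mem_iUnion.2 ⟨j, hsmul j _ (by positivity) x hx⟩, by
        rw [mem_sphere_zero_iff_norm, norm_smul, norm_inv, norm_norm, inv_mul_cancel₀ hn.ne']⟩
      rw [inner_smul_right, inv_mul_eq_div, le_div_iff₀ hn] at h1
      exact h1
  refine ⟨κ, hclosed, fun j x hx y hy => ?_, hsmul, hint, hκ, htrans, fun A hA j => ?_⟩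
  · have h1 := hconvex j hx hy (show (0 : ℝ) ≤ 1 / 2 by norm_num)
      (show (0 : ℝ) ≤ 1 / 2 by norm_num) (by norm_num)
    have h2 := hsmul j 2 (by norm_num) _ h1
    rwa [smul_add, smul_smul, smul_smul, show (2 : ℝ) * (1 / 2) = 1 by norm_num, one_smul,
      one_smul] at h2
  · obtain ⟨l, hl⟩ := hmaps A hA j
    -- The punctured cone is convex, hence connected, so its image lies in only one of the two
    -- disjoint open sets; this makes the sign independent of the vector.
    have hset : K j \ {0} = K j ∩ {x | 0 < inner ℝ w x} := by
      ext x
      refine ⟨fun hx => ⟨hx.1, hpos j x hx.1 hx.2⟩, fun hx => ⟨hx.1, ?_⟩⟩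
      rintro rfl
      simpa using hx.2
    have hconv : Convex ℝ (K j \ {0}) := by
      rw [hset]
      exact (hconvex j).inter (convex_halfSpace_gt (innerSL ℝ w).toLinearMap.isLinear 0)
    have hdisj : Disjoint (interior (K l)) (-interior (K l)) := by
      rw [Set.disjoint_left]
      intro y hy hy'
      have h1 := htrans l y (interior_subset hy)
      have h2 := htrans l (-y) (interior_subset hy')
      rw [norm_neg, inner_neg_right] at h2
      have h3 : ‖y‖ ≤ 0 := by
        by_contra hcon
        have := mul_pos hκ (not_le.1 hcon)
        linarith
      rw [norm_le_zero_iff.1 h3] at hy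
      exact zero_notMem_interior_of_transverse hw
        (fun x hx => (mul_nonneg hκ.le (norm_nonneg x)).trans (htrans l x hx)) hy
    rcases (hconv.isPreconnected.image A A.continuous.continuousOn).subset_or_subset
      isOpen_interior isOpen_interior.neg hdisj hl with h | h
    · exact ⟨l, 1, Or.inl rfl, fun x hx hx0 => by
        rw [one_smul]; exact h ⟨x, ⟨hx, hx0⟩, rfl⟩⟩
    · exact ⟨l, -1, Or.inr rfl, fun x hx hx0 => by
        rw [neg_one_smul]; exact h ⟨x, ⟨hx, hx0⟩, rfl⟩⟩

namespace IsPreMulticone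

variable {ι : Type*} {S : Set (E →L[ℝ] E)} {K : ι → Set E} {w : E} {κ : ℝ}

lemma isCompact_base (h : IsPreMulticone S K w κ) (j : ι) :
    IsCompact (K j ∩ {x | inner ℝ w x = 1}) := by
  refine Metric.isCompact_of_isClosed_isBounded
    ((h.isClosed j).inter (isClosed_eq (by fun_prop) continuous_const)) ?_
  refine (Metric.isBounded_closedBall (x := (0 : E)) (r := 1 / κ)).subset fun x hx => ?_
  have h1 := h.transverse j x hx.1
  have h2 : inner ℝ w x = 1 := hx.2
  rw [mem_closedBall_zero_iff, le_div_iff₀ h.kappa_pos]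
  linarith

omit [FiniteDimensional ℝ E] in
lemma inner_pos (h : IsPreMulticone S K w κ) {j : ι} {x : E} (hx : x ∈ K j) (hx0 : x ≠ 0) :
    0 < inner ℝ w x :=
  (mul_pos h.kappa_pos (norm_pos_iff.2 hx0)).trans_le (h.transverse j x hx)

/-- Over a compact set of operators the cones are strictly preserved in a uniform way. -/
lemma exists_uniform_base [Finite ι] (h : IsPreMulticone S K w κ) (hS : IsCompact S) :
    ∃ θ : ℝ, 0 < θ ∧ θ < 1 ∧ ∀ A ∈ S, ∀ j, ∃ l, ∃ s : ℝ, (s = 1 ∨ s = -1) ∧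
      ∀ q ∈ (K j ∩ {x | inner ℝ w x = 1}) ×ˢ (K j ∩ {x | inner ℝ w x = 1}),
        s • (A q.1 - θ • A q.2) ∈ K l := by
  -- At `θ = 0` this is strict invariance, an open condition; compactness of the bases and of `S`
  -- makes the neighbourhood of `0` uniform.
  have hev : ∀ᶠ θ : ℝ in nhds 0, ∀ A ∈ S, ∀ j, ∃ l, ∃ s : ℝ, (s = 1 ∨ s = -1) ∧
      ∀ q ∈ (K j ∩ {x | inner ℝ w x = 1}) ×ˢ (K j ∩ {x | inner ℝ w x = 1}),
        s • (A q.1 - θ • A q.2) ∈ K l := by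
    refine hS.eventually_forall_of_forall_eventually fun A hA => ?_
    refine Filter.eventually_all.2 fun j => ?_
    obtain ⟨l, s, hs, hl⟩ := h.mapsTo A hA j
    have h1 : ∀ᶠ p : ℝ × (E →L[ℝ] E) in nhds (0, A),
        ∀ q ∈ (K j ∩ {x | inner ℝ w x = 1}) ×ˢ (K j ∩ {x | inner ℝ w x = 1}),
          s • (p.2 q.1 - p.1 • p.2 q.2) ∈ interior (K l) := by
      refine ((h.isCompact_base j).prod (h.isCompact_base j)).eventually_forall_of_forall_eventually
        fun q hq => ?_
      have hcont : Continuous fun z : (ℝ × (E →L[ℝ] E)) × (E × E) =>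
          s • (z.1.2 z.2.1 - z.1.1 • z.1.2 z.2.2) := by fun_prop
      refine hcont.continuousAt.eventually (isOpen_interior.mem_nhds ?_)
      simp only [zero_smul, sub_zero]
      refine hl _ hq.1.1 fun h0 => ?_
      have : inner ℝ w q.1 = 1 := hq.1.2
      rw [h0, inner_zero_right] at this
      exact zero_ne_one this
    filter_upwards [h1] with p hp
    exact ⟨l, s, hs, fun q hq => interior_subset (hp q hq)⟩
  obtain ⟨ρ, hρ, hball⟩ := Metric.eventually_nhds_iff.1 hev
  refine ⟨min (ρ / 2) (1 / 2), by positivity, ?_, hball ?_⟩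
  · exact (min_le_right _ _).trans_lt (by norm_num)
  · rw [Real.dist_eq, sub_zero, abs_of_pos (by positivity)]
    exact (min_le_left _ _).trans_lt (by linarith)

/-- The homogeneous form of `exists_uniform_base`: a comparison of `z` with `t • x` by the
functional `w` alone becomes, after one operator, a comparison in the cone order, at the cost of
`θ`. -/
lemma exists_uniform [Finite ι] (h : IsPreMulticone S K w κ) (hS : IsCompact S) :
    ∃ θ : ℝ, 0 < θ ∧ θ < 1 ∧ ∀ A ∈ S, ∀ j, ∃ l, ∃ s : ℝ, (s = 1 ∨ s = -1) ∧
      (∀ z ∈ K j, s • A z ∈ K l) ∧ ∀ z ∈ K j, ∀ x ∈ K j, ∀ t : ℝ, 0 ≤ t →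
        t * inner ℝ w x ≤ inner ℝ w z → s • (A z - (θ * t) • A x) ∈ K l := by
  obtain ⟨θ, hθ, hθ1, hbase⟩ := h.exists_uniform_base hS
  refine ⟨θ, hθ, hθ1, fun A hA j => ?_⟩
  obtain ⟨l, s, hs, hl⟩ := hbase A hA j
  have hzero : (0 : E) ∈ K l := by
    obtain ⟨x, hx⟩ := h.interior_nonempty l
    simpa using h.smul_mem l 0 le_rfl x (interior_subset hx)
  have hnorm : ∀ x ∈ K j, x ≠ 0 → (inner ℝ w x)⁻¹ • x ∈ K j ∩ {x | inner ℝ w x = 1} := by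
    intro x hx hx0
    have := h.inner_pos hx hx0
    refine ⟨h.smul_mem j _ (by positivity) x hx, ?_⟩
    rw [Set.mem_ofPred_eq, inner_smul_right, inv_mul_cancel₀ this.ne']
  have hmem : ∀ z ∈ K j, z ≠ 0 → ∀ x ∈ K j, x ≠ 0 →
      s • (A z - (θ * (inner ℝ w z / inner ℝ w x)) • A x) ∈ K l := by
    intro z hz hz0 x hx hx0
    have hgz := h.inner_pos hz hz0
    have hgx := h.inner_pos hx hx0
    have h1 := h.smul_mem l (inner ℝ w z) hgz.le _
      (hl (_, _) ⟨hnorm z hz hz0, hnorm x hx hx0⟩)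
    convert h1 using 1
    simp only [map_smul, smul_sub, smul_smul]
    congr 2 <;> field_simp
  have hA : ∀ z ∈ K j, s • A z ∈ K l := by
    intro z hz
    by_cases hz0 : z = 0
    · rw [hz0, map_zero, smul_zero]; exact hzero
    -- Comparing `z` with itself leaves `(1 - θ) • A z`, which is rescaled.
    · have h1 := h.smul_mem l (1 - θ)⁻¹ (inv_nonneg.2 (by linarith)) _ (hmem z hz hz0 z hz hz0)
      rw [div_self (h.inner_pos hz hz0).ne', mul_one] at h1
      convert h1 using 1
      have : 1 - θ ≠ 0 := by linarith
      rw [show A z - θ • A z = (1 - θ) • A z by module, smul_comm s, smul_smul,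
        inv_mul_cancel₀ this, one_smul]
  refine ⟨l, s, hs, hA, fun z hz x hx t ht htz => ?_⟩
  by_cases hx0 : x = 0
  · rw [hx0, map_zero, smul_zero, sub_zero]; exact hA z hz
  have hgx := h.inner_pos hx hx0
  by_cases hz0 : z = 0
  · rw [hz0, inner_zero_right] at htz
    have ht0 : t = 0 := le_antisymm (nonpos_of_mul_nonpos_left htz hgx) ht
    rw [ht0, mul_zero, zero_smul, sub_zero]
    exact hA z hz
  · have h1 := h.smul_mem l (θ * (inner ℝ w z / inner ℝ w x - t)) (by
      refine mul_nonneg hθ.le (sub_nonneg.2 ?_)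
      rwa [le_div_iff₀ hgx]) _ (hA x hx)
    have h2 := h.add_mem l _ (hmem z hz hz0 x hx hx0) _ h1
    convert h2 using 1
    module

/-- Order intervals with respect to the cones are exponentially contracted. -/
lemma exists_interval_contraction [Finite ι] (h : IsPreMulticone S K w κ) (hS : IsCompact S) :
    ∃ ρ : ℝ, 0 < ρ ∧ ρ < 1 ∧ ∀ (j : ι) (x y : E) (a b : ℝ), x ∈ K j → y - a • x ∈ K j →
      b • x - y ∈ K j → a ≤ b → ∀ W : List (E →L[ℝ] E), (∀ A ∈ W, A ∈ S) →
        ∃ l, ∃ s : ℝ, (s = 1 ∨ s = -1) ∧ ∃ a' b' : ℝ, a' ≤ b' ∧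
          b' - a' = ρ ^ W.length * (b - a) ∧ s • W.prod x ∈ K l ∧
          s • W.prod y - a' • (s • W.prod x) ∈ K l ∧
          b' • (s • W.prod x) - s • W.prod y ∈ K l := by
  obtain ⟨θ, hθ, hθ1, huni⟩ := h.exists_uniform hS
  refine ⟨1 - θ / 2, by linarith, by linarith, fun j x y a b hx hya hby hab W => ?_⟩
  induction W with
  | nil =>
    intro _
    exact ⟨j, 1, Or.inl rfl, a, b, hab, by simp, by simpa using hx, by simpa using hya,
      by simpa using hby⟩
  | cons A W ih =>
    intro hW
    obtain ⟨j, s, hs, a, b, hab, hlen, hx, hya, hby⟩ := ih fun D hD => hW D (by simp [hD])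
    obtain ⟨l, s', hs', hA, hθA⟩ := huni A (hW A (by simp)) j
    set x' := s • W.prod x
    set y' := s • W.prod y
    have ex : (s' * s) • (A :: W).prod x = s' • A x' := by
      rw [List.prod_cons, mul_apply_eq_comp, map_smul, smul_smul]
    have ey : (s' * s) • (A :: W).prod y = s' • A y' := by
      rw [List.prod_cons, mul_apply_eq_comp, map_smul, smul_smul]
    have hss : s' * s = 1 ∨ s' * s = -1 := by
      rcases hs with rfl | rfl <;> rcases hs' with rfl | rfl <;> norm_num
    have hsum : inner ℝ w (y' - a • x') + inner ℝ w (b • x' - y') = (b - a) * inner ℝ w x' := by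
      rw [← inner_add_right, show y' - a • x' + (b • x' - y') = (b - a) • x' by module,
        inner_smul_right]
    set t := (b - a) / 2 with ht_def
    have ht : 0 ≤ t := by rw [ht_def]; linarith
    have hba : b - a = 2 * t := by rw [ht_def]; ring
    refine ⟨l, s' * s, hss, ?_⟩
    rw [ex, ey]
    -- The two gaps add up to `(b - a) • x'`, so one of them carries at least half of the
    -- functional. That endpoint moves inward by `θ * (b - a) / 2`, whence the rate `1 - θ / 2`.
    rcases le_or_gt (t * inner ℝ w x') (inner ℝ w (y' - a • x')) with hle | hgt
    · refine ⟨a + θ * t, b, by nlinarith, ?_, hA _ hx, ?_, ?_⟩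
      · rw [List.length_cons, pow_succ, mul_right_comm, ← hlen, hba]
        linear_combination hba
      · convert hθA _ hya _ hx t ht hle using 1
        simp only [map_sub, map_smul]; module
      · convert hA _ hby using 1
        simp only [map_sub, map_smul]; module
    · have hle : t * inner ℝ w x' ≤ inner ℝ w (b • x' - y') := by
        rw [hba] at hsum; linarith
      refine ⟨a, b - θ * t, by nlinarith, ?_, hA _ hx, ?_, ?_⟩
      · rw [List.length_cons, pow_succ, mul_right_comm, ← hlen, hba]
        linear_combination hba
      · convert hA _ hya using 1
        simp only [map_sub, map_smul]; module
      · convert hθA _ hby _ hx t ht hle using 1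
        simp only [map_sub, map_smul]; module

/-- Products of operators preserving a premulticone are dominated. -/
theorem exists_dominated [Finite ι] [Nonempty ι] (h : IsPreMulticone S K w κ)
    (hS : IsCompact S) : ∃ C ρ : ℝ, 0 < C ∧ 0 < ρ ∧ ρ < 1 ∧
      ∀ W : List (E →L[ℝ] E), (∀ A ∈ W, A ∈ S) →
        secondSingularValue W.prod ≤ C * ρ ^ W.length * ‖W.prod‖ := by
  obtain ⟨ρ, hρ, hρ1, hcontr⟩ := h.exists_interval_contraction hS
  obtain ⟨j⟩ := ‹Nonempty ι›
  obtain ⟨x, hx⟩ := h.interior_nonempty j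
  have hκ := h.kappa_pos
  obtain ⟨r, hr, hball⟩ := Metric.mem_nhds_iff.1 (mem_interior_iff_mem_nhds.1 hx)
  -- `4 / r` is the length of the initial interval: since `K j` contains a ball of radius `r` about
  -- `x`, every `y` in the unit ball lies between `-(2 / r) • x` and `(2 / r) • x`.
  set C := 4 / r * (‖w‖ * ‖x‖) / κ with hC
  have hC0 : 0 ≤ C := by positivity
  refine ⟨C + 1, ρ, by positivity, hρ, hρ1, fun W hW => ?_⟩
  refine (secondSingularValue_le_of_near_line W.prod (W.prod x)
    (t := C * ρ ^ W.length * ‖W.prod‖) (by positivity) fun y hy => ?_).trans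
    (by gcongr; linarith)
  have hmem : ∀ σ : ℝ, |σ| ≤ 1 → x + (σ * (r / 2)) • y ∈ K j := by
    intro σ hσ
    refine hball ?_
    rw [Metric.mem_ball, dist_eq_norm, add_sub_cancel_left, norm_smul, Real.norm_eq_abs, abs_mul,
      abs_of_pos (show 0 < r / 2 by positivity)]
    have : |σ| * (r / 2) * ‖y‖ ≤ 1 * (r / 2) * 1 := by gcongr
    linarith
  have h1 : y - (-(2 / r)) • x ∈ K j := by
    convert h.smul_mem j (2 / r) (by positivity) _ (hmem 1 (by simp)) using 1
    rw [smul_add, smul_smul, show 2 / r * (1 * (r / 2)) = 1 by field_simp]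
    module
  have h2 : (2 / r) • x - y ∈ K j := by
    convert h.smul_mem j (2 / r) (by positivity) _ (hmem (-1) (by simp)) using 1
    rw [smul_add, smul_smul, show 2 / r * (-1 * (r / 2)) = -1 by field_simp]
    module
  have hneg : -(2 / r) ≤ 2 / r := by
    have : 0 < 2 / r := by positivity
    linarith
  obtain ⟨l, s, hs, a, b, -, hab, -, hya, hby⟩ :=
    hcontr j x y (-(2 / r)) (2 / r) (interior_subset hx) h1 h2 hneg W hW
  -- The cone vector `s • (W y - a • W x)` has norm at most its `w`-component over `κ`, and that
  -- component is at most the one of `(b - a) • (s • W x)`.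
  refine ⟨a, ?_⟩
  have hsabs : |s| = 1 := by rcases hs with rfl | rfl <;> simp
  have e : ‖W.prod y - a • W.prod x‖ = ‖s • W.prod y - a • (s • W.prod x)‖ := by
    rw [smul_comm a s, ← smul_sub, norm_smul, Real.norm_eq_abs, hsabs, one_mul]
  have hsum : inner ℝ w (s • W.prod y - a • (s • W.prod x)) +
      inner ℝ w (b • (s • W.prod x) - s • W.prod y) = (b - a) * inner ℝ w (s • W.prod x) := by
    rw [← inner_add_right, ← inner_smul_right]
    congr 1
    module
  have h3 := h.transverse l _ hya
  have h4 := (mul_nonneg hκ.le (norm_nonneg _)).trans (h.transverse l _ hby)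
  have h5 : inner ℝ w (s • W.prod x) ≤ ‖w‖ * (‖W.prod‖ * ‖x‖) := by
    refine (real_inner_le_norm _ _).trans ?_
    rw [norm_smul, Real.norm_eq_abs, hsabs, one_mul]
    gcongr
    exact W.prod.le_opNorm x
  have hba : 0 ≤ b - a := by rw [hab]; exact mul_nonneg (by positivity) (by linarith)
  have h6 : (b - a) * inner ℝ w (s • W.prod x) ≤ (b - a) * (‖w‖ * (‖W.prod‖ * ‖x‖)) := by
    gcongr
  have h7 : C * ρ ^ W.length * ‖W.prod‖ = (b - a) * (‖w‖ * (‖W.prod‖ * ‖x‖)) / κ := by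
    rw [hab, hC]; field_simp; ring
  rw [e, h7, le_div_iff₀ hκ]
  linarith

end IsPreMulticone

end ConeContraction

/-! ### Translation between matrices and operators. -/

section Matrices

variable {d : ℕ}

lemma sigma_one_eq_norm [NeZero d] (A : Matrix (Fin d) (Fin d) ℝ) :
    sigma 1 A = ‖Matrix.toEuclideanCLM (n := Fin d) (𝕜 := ℝ) A‖ := by
  rw [← singularValues_zero_eq_norm, Matrix.coe_toEuclideanCLM_eq_toEuclideanLin]
  rfl

lemma sigma_two_eq_secondSingularValue (A : Matrix (Fin d) (Fin d) ℝ) :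
    sigma 2 A = secondSingularValue (Matrix.toEuclideanCLM (n := Fin d) (𝕜 := ℝ) A) := by
  rw [secondSingularValue, Matrix.coe_toEuclideanCLM_eq_toEuclideanLin]
  rfl

lemma continuous_toEuclideanCLM :
    Continuous (Matrix.toEuclideanCLM (n := Fin d) (𝕜 := ℝ)) :=
  LinearMap.continuous_of_finiteDimensional
    ((Matrix.toEuclideanCLM (n := Fin d) (𝕜 := ℝ)).toAlgEquiv.toLinearMap)

lemma exists_list_map_eq {S : Set (Matrix (Fin d) (Fin d) ℝ)}
    (W : List (EuclideanSpace ℝ (Fin d) →L[ℝ] EuclideanSpace ℝ (Fin d)))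
    (hW : ∀ A ∈ W, A ∈ Matrix.toEuclideanCLM (n := Fin d) (𝕜 := ℝ) '' S) :
    ∃ w : List (Matrix (Fin d) (Fin d) ℝ), (∀ A ∈ w, A ∈ S) ∧ w.length = W.length ∧
      Matrix.toEuclideanCLM (n := Fin d) (𝕜 := ℝ) w.prod = W.prod := by
  induction W with
  | nil => exact ⟨[], by simp, rfl, by simp⟩
  | cons B W ih =>
    obtain ⟨w, h1, h2, h3⟩ := ih fun A hA => hW A (by simp [hA])
    obtain ⟨A, hA, rfl⟩ := hW B (by simp)
    refine ⟨A :: w, ?_, by simp [h2], by simp [h3]⟩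
    intro D hD
    rcases List.mem_cons.1 hD with rfl | hD
    · exact hA
    · exact h1 D hD

lemma IsDominated.exists_bound [NeZero d] {S : Set (Matrix (Fin d) (Fin d) ℝ)}
    (h : IsDominated 1 S) : ∃ C r : ℝ, 1 ≤ C ∧ 0 < r ∧ r < 1 ∧
      ∀ W : List (EuclideanSpace ℝ (Fin d) →L[ℝ] EuclideanSpace ℝ (Fin d)),
        (∀ A ∈ W, A ∈ Matrix.toEuclideanCLM (n := Fin d) (𝕜 := ℝ) '' S) →
          secondSingularValue W.prod ≤ C * r ^ W.length * ‖W.prod‖ := by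
  rcases h with h | h | ⟨-, -, C, γ, hC, hγ, hdom⟩
  · exact absurd h one_ne_zero
  -- In dimension one the second singular value is `0`, so any constants serve.
  · refine ⟨1, 1 / 2, le_rfl, by norm_num, by norm_num, fun W _ => ?_⟩
    rw [secondSingularValue, LinearMap.singularValues_of_finrank_le _ (by simp [← h])]
    positivity
  · refine ⟨max C 1, Real.exp (-γ), le_max_right _ _, Real.exp_pos _,
      Real.exp_lt_one_iff.2 (by linarith), fun W hW => ?_⟩
    -- Domination speaks only of nonempty words; the empty one is why `C` is raised to at least `1`.
    rcases Nat.eq_zero_or_pos W.length with h0 | hpos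
    · rw [h0, pow_zero, mul_one]
      exact (secondSingularValue_le_norm _).trans
        (le_mul_of_one_le_left (norm_nonneg _) (le_max_right _ _))
    · obtain ⟨w, hw, hlen, hprod⟩ := exists_list_map_eq W hW
      have h1 := hdom w.length (by omega) w rfl hw
      rw [sigma_two_eq_secondSingularValue, sigma_one_eq_norm, hprod, hlen] at h1
      refine h1.trans ?_
      rw [← Real.exp_nat_mul, mul_comm (W.length : ℝ)]
      gcongr
      exact le_max_left _ _

lemma IsDominated.exists_uniformlyDominated [NeZero d] {S : Set (Matrix (Fin d) (Fin d) ℝ)}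
    (hcompact : IsCompact S) (hinv : ∀ A ∈ S, IsUnit A) (h : IsDominated 1 S) :
    ∃ C r M, UniformlyDominated (Matrix.toEuclideanCLM (n := Fin d) (𝕜 := ℝ) '' S) C r M := by
  obtain ⟨C, r, hC, hr, hr1, hdom⟩ := h.exists_bound
  have hS := hcompact.image (continuous_toEuclideanCLM (d := d))
  have hunit : ∀ B ∈ Matrix.toEuclideanCLM (n := Fin d) (𝕜 := ℝ) '' S, IsUnit B := by
    rintro _ ⟨A, hA, rfl⟩
    exact (hinv A hA).map (Matrix.toEuclideanCLM (n := Fin d) (𝕜 := ℝ))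
  obtain ⟨M1, hM1⟩ := hS.exists_bound_of_continuousOn (f := fun B => B) continuousOn_id
  -- Inversion is continuous at units, so the inverses are bounded over the compact set.
  obtain ⟨M2, hM2⟩ := hS.exists_bound_of_continuousOn (f := Ring.inverse) fun B hB => by
    obtain ⟨u, rfl⟩ := hunit B hB
    exact (NormedRing.inverse_continuousAt u).continuousWithinAt
  refine ⟨C, r, max 1 (max M1 M2), hC, le_max_left _ _, hr, hr1, fun B hB => ?_,
    fun B hB => ⟨Ring.inverse B, Ring.inverse_mul_cancel _ (hunit B hB),
      Ring.mul_inverse_cancel _ (hunit B hB), ?_⟩, hdom⟩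
  · exact (hM1 B hB).trans ((le_max_left _ _).trans (le_max_right _ _))
  · exact (hM2 B hB).trans ((le_max_right _ _).trans (le_max_right _ _))

lemma IsDominated.isMultipositive [NeZero d] {S : Set (Matrix (Fin d) (Fin d) ℝ)}
    (hne : S.Nonempty) (hcompact : IsCompact S) (hinv : ∀ A ∈ S, IsUnit A)
    (h : IsDominated 1 S) : IsMultipositive S := by
  obtain ⟨C, r, M, hUD⟩ := h.exists_uniformlyDominated hcompact hinv
  obtain ⟨F, hFfin, hFne, K, w, κ, hw, hK⟩ := hUD.exists_isPreMulticone (hne.image _)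
  have := hFfin.fintype
  have := hFne.to_subtype
  have hw0 : w ≠ 0 := by
    rw [← norm_pos_iff, hw]; exact one_pos
  obtain ⟨s, K', hK', hdisj⟩ := hK.exists_disjoint hw0
  obtain ⟨m, ⟨e⟩⟩ := Finite.exists_equiv_fin (Quotient s)
  have hm : 1 ≤ m := by
    obtain ⟨f⟩ := ‹Nonempty F›
    exact (e (Quotient.mk s f)).pos
  refine ⟨m, hm, fun j => K' (e.symm j), ?_⟩
  constructor
  · exact fun _ => hK'.isClosed _
  · intro j x hx y hy a b ha hb _
    exact hK'.add_mem _ _ (hK'.smul_mem _ a ha x hx) _ (hK'.smul_mem _ b hb y hy)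
  · exact fun _ => hK'.interior_nonempty _
  · rintro j a ha _ ⟨x, hx, rfl⟩
    exact hK'.smul_mem _ a ha x hx
  · refine ⟨w, hw, fun u hu hu0 => ?_⟩
    obtain ⟨j, hj⟩ := Set.mem_iUnion.1 hu
    rw [real_inner_comm]
    exact hK'.inner_pos hj hu0
  · intro A hA j
    obtain ⟨l, t, ht, hl⟩ := hK'.mapsTo _ ⟨A, hA, rfl⟩ (e.symm j)
    refine ⟨e l, ?_⟩
    rintro _ ⟨x, ⟨hx, hx0⟩, rfl⟩
    have h1 := hl x hx hx0
    rw [Equiv.symm_apply_apply]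
    rcases ht with rfl | rfl
    · rw [one_smul] at h1
      exact Or.inl h1
    · rw [neg_one_smul] at h1
      exact Or.inr h1
  · intro i j hij
    exact hdisj _ _ fun he => hij (e.symm.injective he)

lemma IsMultipositive.isDominated (hd : 1 ≤ d) {S : Set (Matrix (Fin d) (Fin d) ℝ)}
    (hcompact : IsCompact S) (h : IsMultipositive S) : IsDominated 1 S := by
  rcases eq_or_lt_of_le hd with h1 | hlt
  · exact Or.inr (Or.inl h1)
  have : NeZero d := ⟨by omega⟩
  obtain ⟨m, hm, K, hK⟩ := h
  have : NeZero m := ⟨by omega⟩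
  obtain ⟨w, hw, hpos⟩ := hK.transverse
  have hw0 : w ≠ 0 := by
    rw [← norm_pos_iff, hw]; exact one_pos
  obtain ⟨κ, hpre⟩ := isPreMulticone_of_convex
    (S := Matrix.toEuclideanCLM (n := Fin d) (𝕜 := ℝ) '' S) hw0 hK.isClosed hK.convex
    hK.interior_nonempty (fun j a ha x hx => hK.smul_subset j a ha ⟨x, hx, rfl⟩)
    (fun j x hx hx0 => by
      rw [real_inner_comm]; exact hpos x (Set.mem_iUnion.2 ⟨j, hx⟩) hx0)
    (by rintro _ ⟨A, hA, rfl⟩ j; exact hK.mapsTo A hA j)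
  obtain ⟨C, ρ, hC, hρ, hρ1, hdom⟩ :=
    hpre.exists_dominated (hcompact.image continuous_toEuclideanCLM)
  refine Or.inr (Or.inr ⟨le_rfl, hlt, C, -Real.log ρ, hC,
    neg_pos.2 (Real.log_neg hρ hρ1), fun n _ W hlen hW => ?_⟩)
  have h2 := hdom (W.map (Matrix.toEuclideanCLM (n := Fin d) (𝕜 := ℝ))) (by
    intro B hB
    obtain ⟨A, hA, rfl⟩ := List.mem_map.1 hB
    exact ⟨A, hW A hA, rfl⟩)
  rw [← map_list_prod, List.length_map, hlen] at h2
  rw [sigma_two_eq_secondSingularValue, sigma_one_eq_norm, neg_neg, mul_comm (Real.log ρ),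
    Real.exp_nat_mul, Real.exp_log hρ]
  exact h2

end Matrices

theorem propositionA1 (d : ℕ) (hd : 1 ≤ d) (S : Set (Matrix (Fin d) (Fin d) ℝ))
    (hne : S.Nonempty) (hcompact : IsCompact S) (hinv : ∀ A ∈ S, IsUnit A) :
    IsDominated 1 S ↔ IsMultipositive S := by
  have : NeZero d := ⟨by omega⟩
  exact ⟨fun h => h.isMultipositive hne hcompact hinv, fun h => h.isDominated hd hcompact⟩
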